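/- Let $\Omega\subset\mathbb R^d$ be compact and convex with nonempty interior, let $\|\cdot\|$ be an arbitrary norm on $\mathbb R^d$, let $\alpha>0$, and let $\mu_0,\mu_1\in L^1(\Omega)$ be nonnegative. The $L^1$ generalized unnormalized Wasserstein metric is $$UW_1(\mu_0,\mu_1)=\inf_{v,\mu,f}\Big\{\int_0^1\!\!\int_\Omega\|v(t,x)\|\,\mu(t,x)\,dx\,dt+\frac1\alpha\int_0^1\!\!\int_\Omega|f(t,x)|\,dx\,dt:\ \partial_t\mu+\nabla\cdot(\mu v)=f,\ \mu(0,\cdot)=\mu_0,\ \mu(1,\cdot)=\mu_1\Big\},$$ where $t\mapsto\mu(t,\cdot)$ is a continuous path of nonnegative functions in $L^1(\Omega)$, with $\mu$ Borel on $[0,1]\times\Omega$, $v$ and $f$ are Borel on $[0,1]\times\Omega$ with $\mu v$ and $f$ integrable, and the equation holds weakly with zero flux on $[0,1]\times\partial\Omega$: for every $\varphi\in C^\infty(\mathbb R\times\mathbb R^d)$, $$\int_\Omega\varphi(1,x)\mu(1,x)\,dx-\int_\Omega\varphi(0,x)\mu(0,x)\,dx-\int_0^1\!\!\int_\Omega\big(\partial_t\varphi\,\mu+\nabla_x\varphi\cdot\mu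 v\big)\,dx\,dt=\int_0^1\!\!\int_\Omega\varphi f\,dx\,dt.$$ Then $UW_1(\mu_0,\mu_1)$ is finite and equals the value of the minimal flux problem $$\inf_{m,c}\Big\{\int_\Omega\|m(x)\|\,dx+\frac1\alpha\int_\Omega|c(x)|\,dx:\ \mu_1-\mu_0+\nabla\cdot m-c=0\Big\},\qquad(\ast)$$ where $m\in L^1(\Omega;\mathbb R^d)$, $c\in L^1(\Omega)$, and the constraint holds weakly with zero flux on $\partial\Omega$: $\int_\Omega\varphi\,(\mu_1-\mu_0-c)\,dx-\int_\Omega\nabla\varphi\cdot m\,dx=0$ for every $\varphi\in C^\infty(\mathbb R^d)$. If $\mu_0$ and $\mu_1$ are continuous on $\Omega$, the infimum over those admissible triples for which $\mu$ is jointly continuous on $[0,1]\times\Omega$ also equals the value of $(\ast)$. Moreover, there is a Lipschitz function $\Phi:\Omega\to\mathbb R$ such that every minimizer $(m,c)$ of $(\ast)$ satisfies, for almost every $x\in\Omega$, that $\Phi$ is differentiable at $x$ and $$\nabla\Phi(x)\in\partial\|m(x)\|\quad\text{and}\quad\alpha\,\Phi(x)\in\partial|c(x)|,$$ where $\partial\|m(x)\|$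 and $\partial|c(x)|$ are the subdifferentials of $\|\cdot\|$ at $m(x)$ and of $|\cdot|$ at $c(x)$. -/

import Mathlib

open MeasureTheory Set Filter Topology
open scoped ENNReal ContDiff

noncomputable section

namespace UnnormalizedOT

/-- The Euclidean space `ℝ^d`; it carries Lebesgue measure and the dot product. -/
abbrev Space (d : ℕ) : Type := EuclideanSpace ℝ (Fin d)

variable {d : ℕ}

/-- The subdifferential of a function `g` at `x`: the vectors `p` such that
`g x + p · (y - x) ≤ g y` for all `y`. -/
def subdifferential {H : Type*} [NormedAddCommGroup H] [InnerProductSpace ℝ H]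
    (g : H → ℝ) (x : H) : Set H :=
  {p | ∀ y, g x + inner ℝ p (y - x) ≤ g y}

/-- Membership in the set of unnormalized densities: nonnegative `L¹` functions on `Ω`. -/
def IsDensity (Ω : Set (Space d)) (ρ : Space d → ℝ) : Prop :=
  IntegrableOn ρ Ω ∧ ∀ᵐ x ∂(volume.restrict Ω), 0 ≤ ρ x

/-- The unnormalized continuity equation `∂ₜμ + ∇·(μ v) = f` on `[0,1] × Ω`, with zero flux of
`μ v` through `[0,1] × ∂Ω`, in the weak sense. The test functions are smooth up to the boundary
of `[0,1] × Ω` and need not vanish there; this encodes the zero flux condition. -/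
def ContinuityEquation (Ω : Set (Space d))
    (μ : ℝ → Space d → ℝ) (v : ℝ → Space d → Space d) (f : ℝ → Space d → ℝ) : Prop :=
  ∀ φ : ℝ × Space d → ℝ, ContDiff ℝ ∞ φ →
    (∫ x in Ω, φ (1, x) * μ 1 x) - (∫ x in Ω, φ (0, x) * μ 0 x)
      - (∫ p in Icc (0 : ℝ) 1 ×ˢ Ω,
          (deriv (fun s => φ (s, p.2)) p.1 * μ p.1 p.2
            + inner ℝ (gradient (fun y => φ (p.1, y)) p.2) (μ p.1 p.2 • v p.1 p.2)))
      = ∫ p in Icc (0 : ℝ) 1 ×ˢ Ω, φ p * f p.1 p.2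

/-- Admissible triples `(μ, v, f)` of the dynamic problem. The density is a continuous path
`t ↦ μ(t, ·)` of unnormalized densities in `L¹(Ω)` from `μ₀` to `μ₁`, and `v`, `f` are Borel.
The flux `μ v` and the source `f` are integrable; as `μ ≥ 0`, this says exactly that the cost is
finite, and triples of infinite cost do not matter for the infimum. -/
structure IsAdmissible (Ω : Set (Space d)) (μ₀ μ₁ : Space d → ℝ)
    (μ : ℝ → Space d → ℝ) (v : ℝ → Space d → Space d) (f : ℝ → Space d → ℝ) : Prop where
  measurable_density : Measurable (Function.uncurry μ)
  measurable_velocity : Measurable (Function.uncurry v)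
  measurable_source : Measurable (Function.uncurry f)
  isDensity : ∀ t ∈ Icc (0 : ℝ) 1, IsDensity Ω (μ t)
  continuous_path : ∀ s ∈ Icc (0 : ℝ) 1,
    Tendsto (fun t => ∫⁻ x in Ω, ‖μ t x - μ s x‖ₑ) (𝓝[Icc (0 : ℝ) 1] s) (𝓝 0)
  integrable_flux : IntegrableOn (fun p : ℝ × Space d => μ p.1 p.2 • v p.1 p.2)
    (Icc (0 : ℝ) 1 ×ˢ Ω)
  integrable_source : IntegrableOn (fun p : ℝ × Space d => f p.1 p.2) (Icc (0 : ℝ) 1 ×ˢ Ω)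
  initial : μ 0 =ᵐ[volume.restrict Ω] μ₀
  terminal : μ 1 =ᵐ[volume.restrict Ω] μ₁
  continuity_equation : ContinuityEquation Ω μ v f

/-- The dynamic cost `∫₀¹∫_Ω N(v) μ dx dt + (1/α) ∫₀¹∫_Ω |f| dx dt`. -/
def dynamicCost (N : Seminorm ℝ (Space d)) (α : ℝ) (Ω : Set (Space d))
    (μ : ℝ → Space d → ℝ) (v : ℝ → Space d → Space d) (f : ℝ → Space d → ℝ) : ℝ≥0∞ :=
  (∫⁻ p in Icc (0 : ℝ) 1 ×ˢ Ω, ENNReal.ofReal (N (v p.1 p.2) * μ p.1 p.2))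
    + ENNReal.ofReal (1 / α) * ∫⁻ p in Icc (0 : ℝ) 1 ×ˢ Ω, ENNReal.ofReal |f p.1 p.2|

/-- The `L¹` generalized unnormalized Wasserstein metric. -/
def UW₁ (N : Seminorm ℝ (Space d)) (α : ℝ) (Ω : Set (Space d)) (μ₀ μ₁ : Space d → ℝ) : ℝ≥0∞ :=
  ⨅ (μ : ℝ → Space d → ℝ) (v : ℝ → Space d → Space d) (f : ℝ → Space d → ℝ)
    (_ : IsAdmissible Ω μ₀ μ₁ μ v f), dynamicCost N α Ω μ v f

/-- The same infimum, restricted to densities `μ` that are jointly continuous on `[0,1] × Ω`. -/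
def UW₁Continuous (N : Seminorm ℝ (Space d)) (α : ℝ) (Ω : Set (Space d))
    (μ₀ μ₁ : Space d → ℝ) : ℝ≥0∞ :=
  ⨅ (μ : ℝ → Space d → ℝ) (v : ℝ → Space d → Space d) (f : ℝ → Space d → ℝ)
    (_ : IsAdmissible Ω μ₀ μ₁ μ v f)
    (_ : ContinuousOn (Function.uncurry μ) (Icc (0 : ℝ) 1 ×ˢ Ω)), dynamicCost N α Ω μ v f

/-- Feasible pairs `(m, c)` of the static problem: `L¹` fields on `Ω` with
`μ₁ - μ₀ + ∇·m - c = 0` and zero flux of `m` through `∂Ω`, in the weak sense. -/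
structure IsFeasible (Ω : Set (Space d)) (μ₀ μ₁ : Space d → ℝ)
    (m : Space d → Space d) (c : Space d → ℝ) : Prop where
  integrable_flux : IntegrableOn m Ω
  integrable_source : IntegrableOn c Ω
  constraint : ∀ φ : Space d → ℝ, ContDiff ℝ ∞ φ →
    (∫ x in Ω, φ x * (μ₁ x - μ₀ x - c x)) - (∫ x in Ω, inner ℝ (gradient φ x) (m x)) = 0

/-- The static cost `∫_Ω N(m) dx + (1/α) ∫_Ω |c| dx`. -/
def staticCost (N : Seminorm ℝ (Space d)) (α : ℝ) (Ω : Set (Space d))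
    (m : Space d → Space d) (c : Space d → ℝ) : ℝ≥0∞ :=
  (∫⁻ x in Ω, ENNReal.ofReal (N (m x))) + ENNReal.ofReal (1 / α) * ∫⁻ x in Ω, ENNReal.ofReal |c x|

/-- The value of the minimal flux problem. -/
def minimalFlux (N : Seminorm ℝ (Space d)) (α : ℝ) (Ω : Set (Space d))
    (μ₀ μ₁ : Space d → ℝ) : ℝ≥0∞ :=
  ⨅ (m : Space d → Space d) (c : Space d → ℝ) (_ : IsFeasible Ω μ₀ μ₁ m c),
    staticCost N α Ω m c

/-- `(m, c)` is a minimizer of the minimal flux problem. -/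
def IsMinimizer (N : Seminorm ℝ (Space d)) (α : ℝ) (Ω : Set (Space d)) (μ₀ μ₁ : Space d → ℝ)
    (m : Space d → Space d) (c : Space d → ℝ) : Prop :=
  IsFeasible Ω μ₀ μ₁ m c ∧
    ∀ m' c', IsFeasible Ω μ₀ μ₁ m' c' → staticCost N α Ω m c ≤ staticCost N α Ω m' c'

end UnnormalizedOT

end

/-! Dynamic and static problems. Averaging the flux `μ v` and the source `f` over the unit time
interval yields a feasible static pair: test functions independent of time turn the continuity
equation into the static constraint. Since `N` and the absolute value are convex, Jensen's
inequality shows that the cost does not increase. Conversely, a static pair `(m, c)` is run along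
the affine path from `μ₀` to `μ₁` with velocity `m / μ`. The affine path may vanish, so the bump `δ
t (1 - t)` is added; it makes the density positive at intermediate times and costs at most `δ |Ω| /
α`, which disappears as `δ → 0`. The path inherits joint continuity from continuous marginals. The
pair `(0, μ₁ - μ₀)` shows that the value is finite.

Potential. The static value depends only on `ρ = μ₁ - μ₀`, is sublinear in `ρ`, and is at most `‖ρ‖₁
/ α`. Hahn–Banach supports it at `μ₁ - μ₀` by a linear functional lying below it
(`exists_linearMap_le_sublinear`), and the `L¹` bound represents this functional by some `Φ` with
`|Φ| ≤ 1 / α` (`exists_bounded_representation`). Moving the mass of a set `A` by `h` inside the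
convex set `Ω` costs at most `N h · |A|`, so that `Φ (z + h) - Φ z ≤ N h` almost everywhere; hence
`Φ` has a version that is Lipschitz with respect to `N`. This is a dual optimizer, obtained without
assuming that a primal minimizer exists.

Optimality. Mollification admits `Φ` as a test function in the constraint
(`IsFeasible.integral_mul_eq_of_lipschitz`). For a minimizer this gives `∫ (N m - ∇Φ · m) + ∫ (|c| /
α - Φ c) = 0` with both integrands nonnegative, so both vanish almost everywhere. Together with `∇Φ
· y ≤ N y` and `|α Φ| ≤ 1`, these equalities are the two subdifferential inclusions. -/

open scoped NNReal

noncomputable section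

namespace UnnormalizedOT

variable {d : ℕ}

/-! ### Seminorms, integrability of pairings, and slices of smooth test functions -/

theorem seminorm_continuous (N : Seminorm ℝ (Space d)) : Continuous N :=
  N.convexOn.locallyLipschitz.continuous

theorem exists_seminorm_le (N : Seminorm ℝ (Space d)) :
    ∃ C : ℝ, 0 < C ∧ ∀ x, N x ≤ C * ‖x‖ :=
  N.bound_of_continuous_normedSpace (seminorm_continuous N)

theorem integrable_seminorm_comp {β : Type*} [MeasurableSpace β] {ν : Measure β}
    (N : Seminorm ℝ (Space d)) {g : β → Space d} (hg : Integrable g ν) :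
    Integrable (fun x => N (g x)) ν := by
  obtain ⟨C, -, hC⟩ := exists_seminorm_le N
  refine Integrable.mono' (hg.norm.const_mul C)
    ((seminorm_continuous N).comp_aestronglyMeasurable hg.aestronglyMeasurable) ?_
  exact Eventually.of_forall fun x => by
    simpa [abs_of_nonneg (apply_nonneg N _)] using hC (g x)

/-- Jensen's inequality for the convex function `N`; it is what makes time averaging harmless for
the cost. -/
theorem seminorm_integral_le {β : Type*} [MeasurableSpace β] {ν : Measure β}
    [IsProbabilityMeasure ν] (N : Seminorm ℝ (Space d)) {g : β → Space d} (hg : Integrable g ν) :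
    ENNReal.ofReal (N (∫ x, g x ∂ν)) ≤ ∫⁻ x, ENNReal.ofReal (N (g x)) ∂ν := by
  have hNg := integrable_seminorm_comp N hg
  rw [← ofReal_integral_eq_lintegral_ofReal hNg (Eventually.of_forall fun _ => apply_nonneg N _)]
  exact ENNReal.ofReal_le_ofReal (N.convexOn.map_integral_le (seminorm_continuous N).continuousOn
    isClosed_univ (by simp) hg hNg)

/-- The inner product of a bounded field with an integrable field is integrable. -/
theorem integrable_inner_of_bound {β : Type*} [MeasurableSpace β] {ν : Measure β}
    {g m : β → Space d} {C : ℝ} (hg : AEStronglyMeasurable g ν) (hC : ∀ᵐ x ∂ν, ‖g x‖ ≤ C)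
    (hm : Integrable m ν) : Integrable (fun x => inner ℝ (g x) (m x)) ν := by
  refine Integrable.mono' (hm.norm.const_mul C) (hg.inner hm.aestronglyMeasurable) ?_
  filter_upwards [hC] with x hx
  exact (norm_inner_le_norm _ _).trans (mul_le_mul_of_nonneg_right hx (norm_nonneg _))

theorem integrableOn_inner_of_continuous {β : Type*} [MeasurableSpace β] [TopologicalSpace β]
    [T2Space β] [OpensMeasurableSpace β] [SecondCountableTopologyEither β (Space d)]
    {ν : Measure β} {K : Set β} (hK : IsCompact K)
    {g m : β → Space d} (hg : Continuous g) (hm : IntegrableOn m K ν) :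
    IntegrableOn (fun x => inner ℝ (g x) (m x)) K ν := by
  obtain ⟨C, hC⟩ := hK.exists_bound_of_continuousOn hg.continuousOn
  exact integrable_inner_of_bound hg.aestronglyMeasurable
    (ae_restrict_of_forall_mem hK.measurableSet hC) hm

theorem continuous_gradient {φ : Space d → ℝ} (hφ : ContDiff ℝ ∞ φ) : Continuous (gradient φ) :=
  (InnerProductSpace.toDual ℝ (Space d)).symm.continuous.comp (hφ.continuous_fderiv (by simp))

theorem gradient_slice {φ : ℝ × Space d → ℝ} (hφ : ContDiff ℝ ∞ φ) (p : ℝ × Space d) :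
    gradient (fun y => φ (p.1, y)) p.2 = (InnerProductSpace.toDual ℝ (Space d)).symm
      ((fderiv ℝ φ p).comp (ContinuousLinearMap.inr ℝ ℝ (Space d))) := by
  have h : HasFDerivAt φ (fderiv ℝ φ p) (p.1, p.2) :=
    (hφ.differentiable (by simp) p).hasFDerivAt
  have h2 := h.comp p.2 (hasFDerivAt_prodMk_right p.1 p.2)
  rw [gradient]
  congr 1
  exact h2.fderiv

theorem continuous_gradient_slice {φ : ℝ × Space d → ℝ} (hφ : ContDiff ℝ ∞ φ) :
    Continuous (fun p : ℝ × Space d => gradient (fun y => φ (p.1, y)) p.2) := by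
  have h : (fun p : ℝ × Space d => gradient (fun y => φ (p.1, y)) p.2) = _ :=
    funext fun p => gradient_slice hφ p
  rw [h]
  exact (InnerProductSpace.toDual ℝ (Space d)).symm.continuous.comp
    ((hφ.continuous_fderiv (by simp)).clm_comp continuous_const)

theorem hasDerivAt_slice {φ : ℝ × Space d → ℝ} (hφ : ContDiff ℝ ∞ φ) (p : ℝ × Space d) :
    HasDerivAt (fun s => φ (s, p.2)) (fderiv ℝ φ p (1, 0)) p.1 := by
  have h : HasFDerivAt φ (fderiv ℝ φ p) (p.1, p.2) :=
    (hφ.differentiable (by simp) p).hasFDerivAt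
  have h2 : HasDerivAt (fun s : ℝ => (s, p.2)) ((1 : ℝ), (0 : Space d)) p.1 :=
    (hasDerivAt_id p.1).prodMk (hasDerivAt_const p.1 p.2)
  exact h.comp_hasDerivAt p.1 h2

theorem continuous_deriv_slice {φ : ℝ × Space d → ℝ} (hφ : ContDiff ℝ ∞ φ) :
    Continuous (fun p : ℝ × Space d => deriv (fun s => φ (s, p.2)) p.1) := by
  have h : (fun p : ℝ × Space d => deriv (fun s => φ (s, p.2)) p.1) = _ :=
    funext fun p => (hasDerivAt_slice hφ p).deriv
  rw [h]
  exact (hφ.continuous_fderiv (by simp)).clm_apply continuous_const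

theorem restrict_prod (Ω : Set (Space d)) :
    (volume : Measure (ℝ × Space d)).restrict (Icc (0 : ℝ) 1 ×ˢ Ω)
      = ((volume : Measure ℝ).restrict (Icc 0 1)).prod (volume.restrict Ω) :=
  (Measure.prod_restrict _ _).symm

instance : IsProbabilityMeasure ((volume : Measure ℝ).restrict (Icc 0 1)) :=
  ⟨by simp⟩

/-! ### From the dynamic to the static problem: averaging in time -/

theorem IsAdmissible.ae_nonneg {Ω : Set (Space d)} {μ₀ μ₁ : Space d → ℝ} {μ : ℝ → Space d → ℝ}
    {v : ℝ → Space d → Space d} {f : ℝ → Space d → ℝ} (h : IsAdmissible Ω μ₀ μ₁ μ v f) :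
    ∀ᵐ p ∂(volume.restrict (Icc (0 : ℝ) 1 ×ˢ Ω)), 0 ≤ μ p.1 p.2 := by
  rw [restrict_prod]
  refine (Measure.ae_prod_iff_ae_ae (p := fun p : ℝ × Space d => 0 ≤ μ p.1 p.2)
    (measurableSet_le measurable_const h.measurable_density)).2 ?_
  exact ae_restrict_of_forall_mem measurableSet_Icc fun t ht => (h.isDensity t ht).2

theorem IsFeasible.minimalFlux_le {N : Seminorm ℝ (Space d)} {α : ℝ} {Ω : Set (Space d)}
    {μ₀ μ₁ : Space d → ℝ} {m : Space d → Space d} {c : Space d → ℝ}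
    (h : IsFeasible Ω μ₀ μ₁ m c) : minimalFlux N α Ω μ₀ μ₁ ≤ staticCost N α Ω m c :=
  (iInf_le _ m).trans ((iInf_le _ c).trans (iInf_le _ h))

/-- Averaging in time turns an admissible triple into a feasible pair of at most the same cost. -/
theorem IsAdmissible.minimalFlux_le {N : Seminorm ℝ (Space d)} {α : ℝ} {Ω : Set (Space d)}
    (hΩ : IsCompact Ω) {μ₀ μ₁ : Space d → ℝ} {μ : ℝ → Space d → ℝ} {v : ℝ → Space d → Space d}
    {f : ℝ → Space d → ℝ} (hμ₀ : IsDensity Ω μ₀) (hμ₁ : IsDensity Ω μ₁)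
    (h : IsAdmissible Ω μ₀ μ₁ μ v f) :
    minimalFlux N α Ω μ₀ μ₁ ≤ dynamicCost N α Ω μ v f := by
  set ν := (volume : Measure ℝ).restrict (Icc 0 1) with hν
  have : IsFiniteMeasure ((volume : Measure (Space d)).restrict Ω) :=
    ⟨by simpa using hΩ.measure_lt_top⟩
  have hw := h.integrable_flux
  have hs := h.integrable_source
  have hw' := h.integrable_flux
  have hs' := h.integrable_source
  rw [IntegrableOn, restrict_prod] at hw hs
  set m : Space d → Space d := fun x => ∫ t, μ t x • v t x ∂ν with hm
  set c : Space d → ℝ := fun x => ∫ t, f t x ∂ν with hc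
  have hmint : IntegrableOn m Ω := hw.integral_prod_right
  have hcint : IntegrableOn c Ω := hs.integral_prod_right
  have hfeas : IsFeasible Ω μ₀ μ₁ m c := by
    refine ⟨hmint, hcint, fun φ hφ => ?_⟩
    -- A test function independent of time loses the time derivative term, and only time averages of
    -- flux and source remain.
    have hce := h.continuity_equation (fun p => φ p.2) (hφ.comp contDiff_snd)
    have hφc := hφ.continuous
    simp only [deriv_const, zero_mul, zero_add] at hce
    have i1 : ∫ p in Icc (0 : ℝ) 1 ×ˢ Ω, inner ℝ (gradient φ p.2) (μ p.1 p.2 • v p.1 p.2)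
        = ∫ x in Ω, inner ℝ (gradient φ x) (m x) := by
      have hint := integrableOn_inner_of_continuous (isCompact_Icc.prod hΩ)
        ((continuous_gradient hφ).comp continuous_snd) hw'
      rw [IntegrableOn, restrict_prod] at hint
      rw [restrict_prod]
      refine (integral_prod_symm _ hint).trans (integral_congr_ae ?_)
      filter_upwards [hw.prod_left_ae] with x hx
      exact integral_inner (𝕜 := ℝ) hx (gradient φ x)
    have i2 : ∫ p in Icc (0 : ℝ) 1 ×ˢ Ω, φ p.2 * f p.1 p.2 = ∫ x in Ω, φ x * c x := by
      have hint : IntegrableOn (fun p : ℝ × Space d => φ p.2 * f p.1 p.2)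
          (Icc (0 : ℝ) 1 ×ˢ Ω) := IntegrableOn.continuousOn_mul
        (hφc.comp continuous_snd).continuousOn hs' (isCompact_Icc.prod hΩ)
      rw [IntegrableOn, restrict_prod] at hint
      rw [restrict_prod, integral_prod_symm _ hint]
      simp only [integral_const_mul, hc, hν]
    have i3 : ∫ x in Ω, φ x * μ 0 x = ∫ x in Ω, φ x * μ₀ x := by
      refine integral_congr_ae ?_
      filter_upwards [h.initial] with x hx
      rw [hx]
    have i4 : ∫ x in Ω, φ x * μ 1 x = ∫ x in Ω, φ x * μ₁ x := by
      refine integral_congr_ae ?_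
      filter_upwards [h.terminal] with x hx
      rw [hx]
    rw [i1, i2, i3, i4] at hce
    have j0 : IntegrableOn (fun x => φ x * μ₀ x) Ω := hμ₀.1.continuousOn_mul hφc.continuousOn hΩ
    have j1 : IntegrableOn (fun x => φ x * μ₁ x) Ω := hμ₁.1.continuousOn_mul hφc.continuousOn hΩ
    have jc : IntegrableOn (fun x => φ x * c x) Ω := hcint.continuousOn_mul hφc.continuousOn hΩ
    have i5 : ∫ x in Ω, φ x * (μ₁ x - μ₀ x - c x)
        = (∫ x in Ω, φ x * μ₁ x) - (∫ x in Ω, φ x * μ₀ x) - ∫ x in Ω, φ x * c x := by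
      simp only [mul_sub]
      rw [integral_sub (by exact j1.sub j0) jc, integral_sub j1 j0]
    rw [i5]
    linarith
  refine hfeas.minimalFlux_le.trans ?_
  refine add_le_add ?_ (mul_le_mul_right ?_ _)
  -- As `μ ≥ 0`, the kinetic term is a function of the flux alone, namely `N (μ v)`; Jensen then
  -- applies for almost every `x`.
  · have e : ∫⁻ p in Icc (0 : ℝ) 1 ×ˢ Ω, ENNReal.ofReal (N (v p.1 p.2) * μ p.1 p.2)
        = ∫⁻ p in Icc (0 : ℝ) 1 ×ˢ Ω, ENNReal.ofReal (N (μ p.1 p.2 • v p.1 p.2)) := by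
      refine lintegral_congr_ae ?_
      filter_upwards [h.ae_nonneg] with p hp
      rw [map_smul_eq_mul, Real.norm_of_nonneg hp, mul_comm]
    rw [e, restrict_prod, lintegral_prod_symm]
    · refine lintegral_mono_ae ?_
      filter_upwards [hw.prod_left_ae] with x hx
      exact seminorm_integral_le N hx
    · exact ((seminorm_continuous N).comp_aestronglyMeasurable
        hw.aestronglyMeasurable).aemeasurable.ennreal_ofReal
  · rw [restrict_prod, lintegral_prod_symm]
    · refine lintegral_mono fun x => ?_
      simp only [← Real.norm_eq_abs, ofReal_norm]
      exact enorm_integral_le_lintegral_enorm _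
    · exact hs.aestronglyMeasurable.norm.aemeasurable.ennreal_ofReal

theorem minimalFlux_le_UW₁ {N : Seminorm ℝ (Space d)} {α : ℝ} {Ω : Set (Space d)}
    (hΩ : IsCompact Ω) {μ₀ μ₁ : Space d → ℝ} (hμ₀ : IsDensity Ω μ₀) (hμ₁ : IsDensity Ω μ₁) :
    minimalFlux N α Ω μ₀ μ₁ ≤ UW₁ N α Ω μ₀ μ₁ :=
  le_iInf fun _ => le_iInf fun _ => le_iInf fun _ => le_iInf fun h => h.minimalFlux_le hΩ hμ₀ hμ₁

theorem UW₁_le_UW₁Continuous (N : Seminorm ℝ (Space d)) (α : ℝ) (Ω : Set (Space d))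
    (μ₀ μ₁ : Space d → ℝ) : UW₁ N α Ω μ₀ μ₁ ≤ UW₁Continuous N α Ω μ₀ μ₁ :=
  iInf_mono fun _ => iInf_mono fun _ => iInf_mono fun _ => le_iInf fun h => le_iInf fun _ =>
    iInf_le _ h

/-! ### From the static to the dynamic problem: a positive path between the marginals -/

/-- The path from `ρ₀` to `ρ₁` that is affine up to a bump of height at most `δ`, which keeps it
positive at intermediate times. -/
def bumpPath (δ : ℝ) (ρ₀ ρ₁ : Space d → ℝ) (t : ℝ) (x : Space d) : ℝ :=
  (1 - t) * ρ₀ x + t * ρ₁ x + δ * (t * (1 - t))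

section BumpPath

variable {Ω : Set (Space d)} {ρ₀ ρ₁ : Space d → ℝ} {δ : ℝ}

theorem measurable_bumpPath (h₀ : Measurable ρ₀) (h₁ : Measurable ρ₁) :
    Measurable (Function.uncurry (bumpPath δ ρ₀ ρ₁)) := by
  unfold bumpPath Function.uncurry
  fun_prop

theorem integrableOn_bumpPath (hΩ : IsCompact Ω) (h₀ : IntegrableOn ρ₀ Ω) (h₁ : IntegrableOn ρ₁ Ω)
    (t : ℝ) : IntegrableOn (bumpPath δ ρ₀ ρ₁ t) Ω :=
  ((h₀.const_mul _).add (h₁.const_mul _)).add (integrableOn_const hΩ.measure_lt_top.ne)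

theorem isDensity_bumpPath (hΩ : IsCompact Ω) (hδ : 0 ≤ δ) (h₀ : IsDensity Ω ρ₀)
    (h₁ : IsDensity Ω ρ₁) {t : ℝ} (ht : t ∈ Icc (0 : ℝ) 1) :
    IsDensity Ω (bumpPath δ ρ₀ ρ₁ t) := by
  refine ⟨integrableOn_bumpPath hΩ h₀.1 h₁.1 t, ?_⟩
  have h1 : 0 ≤ 1 - t := sub_nonneg.2 ht.2
  have h2 := ht.1
  filter_upwards [h₀.2, h₁.2] with x hx₀ hx₁
  unfold bumpPath
  positivity

theorem bumpPath_pos (hδ : 0 < δ) {x : Space d} (h₀ : 0 ≤ ρ₀ x) (h₁ : 0 ≤ ρ₁ x) {t : ℝ}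
    (ht : t ∈ Ioo (0 : ℝ) 1) : 0 < bumpPath δ ρ₀ ρ₁ t x := by
  have h1 : 0 < 1 - t := sub_pos.2 ht.2
  have h2 := ht.1
  unfold bumpPath
  positivity

/-- The factor `t - s` makes the path Lipschitz in time with values in `L¹` for `t`, `s` in `[0,1]`,
which gives its continuity. -/
theorem bumpPath_sub (t s : ℝ) (x : Space d) : bumpPath δ ρ₀ ρ₁ t x - bumpPath δ ρ₀ ρ₁ s x
    = (t - s) * (ρ₁ x - ρ₀ x + δ * (1 - t - s)) := by
  unfold bumpPath
  ring

theorem hasDerivAt_bumpPath (t : ℝ) (x : Space d) :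
    HasDerivAt (fun s => bumpPath δ ρ₀ ρ₁ s x) (ρ₁ x - ρ₀ x + δ * (1 - 2 * t)) t := by
  unfold bumpPath
  have h := hasDerivAt_id t
  have h' := (h.const_sub 1)
  refine (((h'.mul_const (ρ₀ x)).add (h.mul_const (ρ₁ x))).add
    ((h.mul h').const_mul δ)).congr_deriv ?_
  simp only [id]
  ring

theorem tendsto_bumpPath (hΩ : IsCompact Ω) (h₀ : IntegrableOn ρ₀ Ω) (h₁ : IntegrableOn ρ₁ Ω)
    (s : ℝ) : Tendsto (fun t => ∫⁻ x in Ω, ‖bumpPath δ ρ₀ ρ₁ t x - bumpPath δ ρ₀ ρ₁ s x‖ₑ)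
      (𝓝[Icc (0 : ℝ) 1] s) (𝓝 0) := by
  have hfin : ∫⁻ x in Ω, ‖ρ₁ x - ρ₀ x‖ₑ ≠ ⊤ := (h₁.sub h₀).2.ne
  set M : ℝ≥0∞ := (∫⁻ x in Ω, ‖ρ₁ x - ρ₀ x‖ₑ) with hM
  have e : ∀ t, ∫⁻ x in Ω, ‖bumpPath δ ρ₀ ρ₁ t x - bumpPath δ ρ₀ ρ₁ s x‖ₑ
      ≤ ‖t - s‖ₑ * (M + ‖δ * (1 - t - s)‖ₑ * volume Ω) := by
    intro t
    simp only [bumpPath_sub, enorm_mul (t - s)]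
    rw [lintegral_const_mul' _ _ enorm_ne_top]
    refine mul_le_mul_right ?_ _
    calc _ ≤ ∫⁻ x in Ω, (‖ρ₁ x - ρ₀ x‖ₑ + ‖δ * (1 - t - s)‖ₑ) :=
          lintegral_mono fun x => enorm_add_le _ _
      _ = _ := by rw [lintegral_add_right _ measurable_const]; simp [M]
  have lim : Tendsto (fun t : ℝ => ‖t - s‖ₑ * (M + ‖δ * (1 - t - s)‖ₑ * volume Ω)) (𝓝 s)
      (𝓝 (‖s - s‖ₑ * (M + ‖δ * (1 - s - s)‖ₑ * volume Ω))) := by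
    have c1 : Tendsto (fun t : ℝ => ‖t - s‖ₑ) (𝓝 s) (𝓝 ‖s - s‖ₑ) :=
      (by fun_prop : Continuous fun t : ℝ => ‖t - s‖ₑ).tendsto s
    have c2 : Tendsto (fun t : ℝ => ‖δ * (1 - t - s)‖ₑ) (𝓝 s) (𝓝 ‖δ * (1 - s - s)‖ₑ) :=
      (by fun_prop : Continuous fun t : ℝ => ‖δ * (1 - t - s)‖ₑ).tendsto s
    refine ENNReal.Tendsto.mul c1 (Or.inr ?_) (tendsto_const_nhds.add
      (ENNReal.Tendsto.mul_const c2 (Or.inr hΩ.measure_lt_top.ne))) (Or.inr (by simp))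
    exact ENNReal.add_ne_top.2 ⟨hfin, ENNReal.mul_ne_top enorm_ne_top hΩ.measure_lt_top.ne⟩
  have lim0 := lim.mono_left (nhdsWithin_le_nhds (s := Icc (0 : ℝ) 1))
  rw [sub_self, enorm_zero, zero_mul] at lim0
  exact tendsto_of_tendsto_of_tendsto_of_le_of_le tendsto_const_nhds lim0 (fun _ => zero_le) e

theorem integrableOn_uncurry_bumpPath (hΩ : IsCompact Ω) (h₀ : IntegrableOn ρ₀ Ω)
    (h₁ : IntegrableOn ρ₁ Ω) : IntegrableOn (fun p : ℝ × Space d => bumpPath δ ρ₀ ρ₁ p.1 p.2)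
      (Icc (0 : ℝ) 1 ×ˢ Ω) := by
  have hK := (isCompact_Icc (a := (0 : ℝ)) (b := 1)).prod hΩ
  have c₀ : IntegrableOn (fun p : ℝ × Space d => ρ₀ p.2) (Icc (0 : ℝ) 1 ×ˢ Ω) := by
    rw [IntegrableOn, restrict_prod]
    exact h₀.comp_snd _
  have c₁ : IntegrableOn (fun p : ℝ × Space d => ρ₁ p.2) (Icc (0 : ℝ) 1 ×ˢ Ω) := by
    rw [IntegrableOn, restrict_prod]
    exact h₁.comp_snd _
  refine ((c₀.continuousOn_mul (g := fun p => 1 - p.1) (by fun_prop) hK).add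
    (c₁.continuousOn_mul (g := fun p => p.1) (by fun_prop) hK)).add ?_
  exact ContinuousOn.integrableOn_compact hK (by fun_prop)

/-- Integration by parts in time along `bumpPath`. -/
theorem setIntegral_deriv_mul_bumpPath (hΩ : IsCompact Ω) (h₀ : IntegrableOn ρ₀ Ω)
    (h₁ : IntegrableOn ρ₁ Ω) {φ : ℝ × Space d → ℝ} (hφ : ContDiff ℝ ∞ φ) :
    ∫ p in Icc (0 : ℝ) 1 ×ˢ Ω, deriv (fun s => φ (s, p.2)) p.1 * bumpPath δ ρ₀ ρ₁ p.1 p.2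
      = (∫ x in Ω, φ (1, x) * ρ₁ x) - (∫ x in Ω, φ (0, x) * ρ₀ x)
        - ∫ p in Icc (0 : ℝ) 1 ×ˢ Ω, φ p * (ρ₁ p.2 - ρ₀ p.2 + δ * (1 - 2 * p.1)) := by
  have : IsFiniteMeasure ((volume : Measure (Space d)).restrict Ω) :=
    ⟨by simpa using hΩ.measure_lt_top⟩
  have hK := (isCompact_Icc (a := (0 : ℝ)) (b := 1)).prod hΩ
  have hφc := hφ.continuous
  have iA : IntegrableOn (fun p : ℝ × Space d =>
      deriv (fun s => φ (s, p.2)) p.1 * bumpPath δ ρ₀ ρ₁ p.1 p.2) (Icc (0 : ℝ) 1 ×ˢ Ω) :=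
    (integrableOn_uncurry_bumpPath hΩ h₀ h₁).continuousOn_mul
      (continuous_deriv_slice hφ).continuousOn hK
  have iB : IntegrableOn (fun p : ℝ × Space d =>
      φ p * (ρ₁ p.2 - ρ₀ p.2 + δ * (1 - 2 * p.1))) (Icc (0 : ℝ) 1 ×ˢ Ω) := by
    refine IntegrableOn.continuousOn_mul hφc.continuousOn ?_ hK
    refine Integrable.add ?_ (ContinuousOn.integrableOn_compact hK (by fun_prop))
    rw [restrict_prod]
    exact (h₁.sub h₀).comp_snd _
  have j0 : IntegrableOn (fun x => φ (0, x) * ρ₀ x) Ω :=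
    h₀.continuousOn_mul (g := fun x => φ (0, x)) (by fun_prop) hΩ
  have j1 : IntegrableOn (fun x => φ (1, x) * ρ₁ x) Ω :=
    h₁.continuousOn_mul (g := fun x => φ (1, x)) (by fun_prop) hΩ
  rw [eq_sub_iff_add_eq, ← integral_sub j1 j0, ← integral_add iA iB, restrict_prod,
    integral_prod_symm]
  -- For fixed `x` this is the fundamental theorem of calculus for `t ↦ φ (t, x) * bumpPath δ ρ₀ ρ₁
  -- t x`.
  · refine integral_congr_ae (Eventually.of_forall fun x => ?_)
    have hd : ∀ t : ℝ, HasDerivAt (fun s => φ (s, x) * bumpPath δ ρ₀ ρ₁ s x)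
        (deriv (fun s => φ (s, x)) t * bumpPath δ ρ₀ ρ₁ t x
          + φ (t, x) * (ρ₁ x - ρ₀ x + δ * (1 - 2 * t))) t := fun t =>
      ((hasDerivAt_slice hφ (t, x)).differentiableAt.hasDerivAt).mul (hasDerivAt_bumpPath t x)
    have hcont : Continuous fun t : ℝ => deriv (fun s => φ (s, x)) t * bumpPath δ ρ₀ ρ₁ t x
          + φ (t, x) * (ρ₁ x - ρ₀ x + δ * (1 - 2 * t)) := by
      have h1 : Continuous fun t : ℝ => deriv (fun s => φ (s, x)) t :=
        (continuous_deriv_slice hφ).comp (by fun_prop : Continuous fun t : ℝ => (t, x))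
      have h2 : Continuous fun t : ℝ => bumpPath δ ρ₀ ρ₁ t x := by
        unfold bumpPath
        fun_prop
      fun_prop
    have hft := intervalIntegral.integral_eq_sub_of_hasDerivAt (fun t _ => hd t)
      (hcont.intervalIntegrable 0 1)
    rw [intervalIntegral.integral_of_le zero_le_one, ← integral_Icc_eq_integral_Ioc] at hft
    simp only []
    rw [hft]
    simp [bumpPath]
  · rw [← restrict_prod]
    exact iA.add iB

/-- A feasible pair, run at constant speed along `bumpPath`, is admissible for the dynamic
problem at an arbitrarily small extra cost. -/
theorem IsFeasible.exists_isAdmissible (N : Seminorm ℝ (Space d)) {α : ℝ}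
    (hΩ : IsCompact Ω) {μ₀ μ₁ : Space d → ℝ} {m : Space d → Space d} {c : Space d → ℝ}
    (h : IsFeasible Ω μ₀ μ₁ m c)
    (hm : Measurable m) (hc : Measurable c) (h₀ : IsDensity Ω ρ₀) (h₁ : IsDensity Ω ρ₁)
    (hm₀ : Measurable ρ₀) (hm₁ : Measurable ρ₁) (e₀ : ρ₀ =ᵐ[volume.restrict Ω] μ₀)
    (e₁ : ρ₁ =ᵐ[volume.restrict Ω] μ₁) (hδ : 0 < δ) :
    ∃ v f, IsAdmissible Ω μ₀ μ₁ (bumpPath δ ρ₀ ρ₁) v f ∧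
      dynamicCost N α Ω (bumpPath δ ρ₀ ρ₁) v f
        ≤ staticCost N α Ω m c + ENNReal.ofReal (1 / α) * (ENNReal.ofReal δ * volume Ω) := by
  have : IsFiniteMeasure ((volume : Measure (Space d)).restrict Ω) :=
    ⟨by simpa using hΩ.measure_lt_top⟩
  have hK := (isCompact_Icc (a := (0 : ℝ)) (b := 1)).prod hΩ
  -- The velocity makes the flux equal to `m` at almost every time and place; the source is `c` plus
  -- the time derivative `δ (1 - 2 t)` of the bump.
  set v : ℝ → Space d → Space d := fun t x => (bumpPath δ ρ₀ ρ₁ t x)⁻¹ • m x with hv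
  set f : ℝ → Space d → ℝ := fun t x => c x + δ * (1 - 2 * t) with hf
  have hpos : ∀ᵐ p ∂(volume.restrict (Icc (0 : ℝ) 1 ×ˢ Ω)), 0 < bumpPath δ ρ₀ ρ₁ p.1 p.2 := by
    rw [restrict_prod]
    refine (Measure.ae_prod_iff_ae_ae (p := fun p : ℝ × Space d => 0 < bumpPath δ ρ₀ ρ₁ p.1 p.2)
      (measurableSet_lt measurable_const (measurable_bumpPath hm₀ hm₁))).2 ?_
    -- The bump vanishes at both endpoints, where the density may be zero; they form a null set of
    -- times.
    rw [← restrict_Ioo_eq_restrict_Icc]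
    refine ae_restrict_of_forall_mem measurableSet_Ioo fun t ht => ?_
    filter_upwards [h₀.2, h₁.2] with x hx₀ hx₁
    exact bumpPath_pos hδ hx₀ hx₁ ht
  have hflux : ∀ᵐ p ∂(volume.restrict (Icc (0 : ℝ) 1 ×ˢ Ω)),
      bumpPath δ ρ₀ ρ₁ p.1 p.2 • v p.1 p.2 = m p.2 := by
    filter_upwards [hpos] with p hp
    simp only [hv, smul_inv_smul₀ hp.ne']
  have im : IntegrableOn (fun p : ℝ × Space d => m p.2) (Icc (0 : ℝ) 1 ×ˢ Ω) := by
    rw [IntegrableOn, restrict_prod]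
    exact h.integrable_flux.comp_snd _
  have if' : IntegrableOn (fun p : ℝ × Space d => f p.1 p.2) (Icc (0 : ℝ) 1 ×ˢ Ω) := by
    refine Integrable.add ?_ (ContinuousOn.integrableOn_compact hK (by fun_prop))
    rw [restrict_prod]
    exact h.integrable_source.comp_snd _
  refine ⟨v, f, ?_, ?_⟩
  · refine ⟨measurable_bumpPath hm₀ hm₁, ?_, ?_, fun t ht => isDensity_bumpPath hΩ hδ.le h₀ h₁ ht,
      fun s _ => tendsto_bumpPath hΩ h₀.1 h₁.1 s, im.congr (hflux.mono fun p hp => hp.symm), if',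
      ?_, ?_, fun φ hφ => ?_⟩
    · exact (measurable_bumpPath hm₀ hm₁).inv.smul (hm.comp measurable_snd)
    · unfold f Function.uncurry
      fun_prop
    · filter_upwards [e₀] with x hx
      simp [bumpPath, hx]
    · filter_upwards [e₁] with x hx
      simp [bumpPath, hx]
    have hφc := hφ.continuous
    have b0 : ∀ x, bumpPath δ ρ₀ ρ₁ 0 x = ρ₀ x := fun x => by simp [bumpPath]
    have b1 : ∀ x, bumpPath δ ρ₀ ρ₁ 1 x = ρ₁ x := fun x => by simp [bumpPath]
    simp only [b0, b1]
    have iA : IntegrableOn (fun p : ℝ × Space d =>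
        deriv (fun s => φ (s, p.2)) p.1 * bumpPath δ ρ₀ ρ₁ p.1 p.2) (Icc (0 : ℝ) 1 ×ˢ Ω) :=
      (integrableOn_uncurry_bumpPath hΩ h₀.1 h₁.1).continuousOn_mul
        (continuous_deriv_slice hφ).continuousOn hK
    have iG : IntegrableOn (fun p : ℝ × Space d =>
        inner ℝ (gradient (fun y => φ (p.1, y)) p.2) (m p.2)) (Icc (0 : ℝ) 1 ×ˢ Ω) :=
      integrableOn_inner_of_continuous hK (continuous_gradient_slice hφ) im
    have ir : IntegrableOn (fun p : ℝ × Space d => ρ₁ p.2 - ρ₀ p.2) (Icc (0 : ℝ) 1 ×ˢ Ω) := by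
      rw [IntegrableOn, restrict_prod]
      exact (h₁.1.sub h₀.1).comp_snd _
    have ic : IntegrableOn (fun p : ℝ × Space d => c p.2) (Icc (0 : ℝ) 1 ×ˢ Ω) := by
      rw [IntegrableOn, restrict_prod]
      exact h.integrable_source.comp_snd _
    have iS : IntegrableOn (fun p : ℝ × Space d => φ p * (ρ₁ p.2 - ρ₀ p.2 - c p.2))
        (Icc (0 : ℝ) 1 ×ˢ Ω) :=
      IntegrableOn.continuousOn_mul hφc.continuousOn (ir.sub ic) hK
    have iB : IntegrableOn (fun p : ℝ × Space d =>
        φ p * (ρ₁ p.2 - ρ₀ p.2 + δ * (1 - 2 * p.1))) (Icc (0 : ℝ) 1 ×ˢ Ω) :=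
      IntegrableOn.continuousOn_mul hφc.continuousOn
        (ir.add (ContinuousOn.integrableOn_compact hK (by fun_prop))) hK
    have s1 : ∫ p in Icc (0 : ℝ) 1 ×ˢ Ω, (deriv (fun s => φ (s, p.2)) p.1
          * bumpPath δ ρ₀ ρ₁ p.1 p.2 + inner ℝ (gradient (fun y => φ (p.1, y)) p.2)
            (bumpPath δ ρ₀ ρ₁ p.1 p.2 • v p.1 p.2))
        = (∫ p in Icc (0 : ℝ) 1 ×ˢ Ω, deriv (fun s => φ (s, p.2)) p.1
            * bumpPath δ ρ₀ ρ₁ p.1 p.2)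
          + ∫ p in Icc (0 : ℝ) 1 ×ˢ Ω, inner ℝ (gradient (fun y => φ (p.1, y)) p.2) (m p.2) := by
      rw [← integral_add iA iG]
      refine integral_congr_ae ?_
      filter_upwards [hflux] with p hp
      rw [hp]
    -- At each time `t` the static constraint is tested with the slice `φ (t, ·)`.
    have s2 : ∫ p in Icc (0 : ℝ) 1 ×ˢ Ω, inner ℝ (gradient (fun y => φ (p.1, y)) p.2) (m p.2)
        = ∫ p in Icc (0 : ℝ) 1 ×ˢ Ω, φ p * (ρ₁ p.2 - ρ₀ p.2 - c p.2) := by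
      rw [IntegrableOn, restrict_prod] at iG iS
      rw [restrict_prod, integral_prod _ iG, integral_prod _ iS]
      refine integral_congr_ae (Eventually.of_forall fun t => ?_)
      have hct := h.constraint (fun x => φ (t, x)) (hφ.comp (contDiff_const.prodMk contDiff_id))
      have e : ∫ x in Ω, φ (t, x) * (ρ₁ x - ρ₀ x - c x)
          = ∫ x in Ω, φ (t, x) * (μ₁ x - μ₀ x - c x) := by
        refine integral_congr_ae ?_
        filter_upwards [e₀, e₁] with x hx₀ hx₁
        rw [hx₀, hx₁]
      simp only []
      rw [e]
      linarith
    have s3 : ∫ p in Icc (0 : ℝ) 1 ×ˢ Ω, φ p * f p.1 p.2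
        = (∫ p in Icc (0 : ℝ) 1 ×ˢ Ω, φ p * (ρ₁ p.2 - ρ₀ p.2 + δ * (1 - 2 * p.1)))
          - ∫ p in Icc (0 : ℝ) 1 ×ˢ Ω, φ p * (ρ₁ p.2 - ρ₀ p.2 - c p.2) := by
      rw [← integral_sub iB iS]
      refine integral_congr_ae (Eventually.of_forall fun p => ?_)
      simp only [hf]
      ring
    rw [s1, s2, s3, setIntegral_deriv_mul_bumpPath hΩ h₀.1 h₁.1 hφ]
    ring
  · have k1 : ∫⁻ p in Icc (0 : ℝ) 1 ×ˢ Ω, ENNReal.ofReal (N (v p.1 p.2) * bumpPath δ ρ₀ ρ₁ p.1 p.2)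
        = ∫⁻ x in Ω, ENNReal.ofReal (N (m x)) := by
      have e : ∫⁻ p in Icc (0 : ℝ) 1 ×ˢ Ω,
            ENNReal.ofReal (N (v p.1 p.2) * bumpPath δ ρ₀ ρ₁ p.1 p.2)
          = ∫⁻ p in Icc (0 : ℝ) 1 ×ˢ Ω, ENNReal.ofReal (N (m p.2)) := by
        refine lintegral_congr_ae ?_
        filter_upwards [hpos, hflux] with p hp hfl
        rw [← hfl, map_smul_eq_mul N (bumpPath δ ρ₀ ρ₁ p.1 p.2), Real.norm_of_nonneg hp.le, mul_comm]
      have hmeas : Measurable fun p : ℝ × Space d => ENNReal.ofReal (N (m p.2)) :=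
        ((seminorm_continuous N).measurable.comp (hm.comp measurable_snd)).ennreal_ofReal
      rw [e, restrict_prod, lintegral_prod _ hmeas.aemeasurable]
      simp
    have k2 : ∫⁻ p in Icc (0 : ℝ) 1 ×ˢ Ω, ENNReal.ofReal |f p.1 p.2|
        ≤ (∫⁻ x in Ω, ENNReal.ofReal |c x|) + ENNReal.ofReal δ * volume Ω := by
      have hmeas : Measurable fun p : ℝ × Space d => ENNReal.ofReal |c p.2| + ENNReal.ofReal δ := by
        fun_prop
      calc ∫⁻ p in Icc (0 : ℝ) 1 ×ˢ Ω, ENNReal.ofReal |f p.1 p.2|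
          ≤ ∫⁻ p in Icc (0 : ℝ) 1 ×ˢ Ω, (ENNReal.ofReal |c p.2| + ENNReal.ofReal δ) := by
            refine setLIntegral_mono hmeas fun p hp => ?_
            rw [← ENNReal.ofReal_add (abs_nonneg _) hδ.le]
            refine ENNReal.ofReal_le_ofReal ((abs_add_le _ _).trans ?_)
            have hp1 := hp.1
            have : |1 - 2 * p.1| ≤ 1 := abs_le.2 ⟨by linarith [hp1.2], by linarith [hp1.1]⟩
            rw [abs_mul, abs_of_pos hδ]
            linarith [mul_le_mul_of_nonneg_left this hδ.le]
        _ = _ := by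
            rw [restrict_prod, lintegral_prod _ hmeas.aemeasurable]
            simp [lintegral_add_right]
    rw [dynamicCost, staticCost, k1, add_assoc, ← mul_add]
    exact add_le_add_right (mul_le_mul_right k2 _) _

end BumpPath

/-! ### Equality and finiteness of the values -/

theorem IsFeasible.congr {Ω : Set (Space d)} {μ₀ μ₁ : Space d → ℝ} {m m' : Space d → Space d}
    {c c' : Space d → ℝ} (h : IsFeasible Ω μ₀ μ₁ m c) (hm : m =ᵐ[volume.restrict Ω] m')
    (hc : c =ᵐ[volume.restrict Ω] c') : IsFeasible Ω μ₀ μ₁ m' c' := by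
  refine ⟨h.integrable_flux.congr hm, h.integrable_source.congr hc, fun φ hφ => ?_⟩
  rw [← h.constraint φ hφ]
  congr 1
  · refine integral_congr_ae ?_
    filter_upwards [hc] with x hx
    rw [hx]
  · refine integral_congr_ae ?_
    filter_upwards [hm] with x hx
    rw [hx]

theorem staticCost_congr {N : Seminorm ℝ (Space d)} {α : ℝ} {Ω : Set (Space d)}
    {m m' : Space d → Space d} {c c' : Space d → ℝ} (hm : m =ᵐ[volume.restrict Ω] m')
    (hc : c =ᵐ[volume.restrict Ω] c') : staticCost N α Ω m c = staticCost N α Ω m' c' := by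
  unfold staticCost
  congr 1
  · exact lintegral_congr_ae (hm.mono fun x hx => by simp only [hx])
  · congr 1
    exact lintegral_congr_ae (hc.mono fun x hx => by simp only [hx])

/-- For every feasible pair and every pair of Borel representatives of the marginals there are
admissible triples along `bumpPath` whose costs are arbitrarily close to the static cost. -/
theorem le_minimalFlux_of_forall_bumpPath {N : Seminorm ℝ (Space d)} {α : ℝ}
    {Ω : Set (Space d)} (hΩ : IsCompact Ω) {μ₀ μ₁ ρ₀ ρ₁ : Space d → ℝ}
    (h₀ : IsDensity Ω ρ₀) (h₁ : IsDensity Ω ρ₁) (hm₀ : Measurable ρ₀) (hm₁ : Measurable ρ₁)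
    (e₀ : ρ₀ =ᵐ[volume.restrict Ω] μ₀) (e₁ : ρ₁ =ᵐ[volume.restrict Ω] μ₁) {a : ℝ≥0∞}
    (ha : ∀ δ v f, IsAdmissible Ω μ₀ μ₁ (bumpPath δ ρ₀ ρ₁) v f →
      a ≤ dynamicCost N α Ω (bumpPath δ ρ₀ ρ₁) v f) :
    a ≤ minimalFlux N α Ω μ₀ μ₁ := by
  refine le_iInf fun m => le_iInf fun c => le_iInf fun h => ?_
  have hm := h.integrable_flux.aestronglyMeasurable
  have hc := h.integrable_source.aestronglyMeasurable
  -- Borel representatives are needed because the dynamic problem requires Borel velocity and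
  -- source.
  have h' := h.congr hm.ae_eq_mk hc.ae_eq_mk
  have hδ : ∀ δ : ℝ, 0 < δ → a ≤ staticCost N α Ω m c
      + ENNReal.ofReal (1 / α) * (ENNReal.ofReal δ * volume Ω) := by
    intro δ hδ
    obtain ⟨v, f, hadm, hcost⟩ := h'.exists_isAdmissible N hΩ
      hm.stronglyMeasurable_mk.measurable hc.stronglyMeasurable_mk.measurable h₀ h₁ hm₀ hm₁ e₀ e₁ hδ
    rw [staticCost_congr hm.ae_eq_mk hc.ae_eq_mk]
    exact (ha δ v f hadm).trans hcost
  have lim : Tendsto (fun δ : ℝ => staticCost N α Ω m c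
      + ENNReal.ofReal (1 / α) * (ENNReal.ofReal δ * volume Ω)) (𝓝[>] 0)
      (𝓝 (staticCost N α Ω m c + ENNReal.ofReal (1 / α) * (ENNReal.ofReal 0 * volume Ω))) := by
    refine tendsto_const_nhds.add (ENNReal.Tendsto.const_mul (ENNReal.Tendsto.mul_const
      ((ENNReal.continuous_ofReal.tendsto 0).mono_left nhdsWithin_le_nhds)
      (Or.inr hΩ.measure_lt_top.ne)) (Or.inr ENNReal.ofReal_ne_top))
  simp only [ENNReal.ofReal_zero, zero_mul, mul_zero, add_zero] at lim
  refine ge_of_tendsto lim ?_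
  filter_upwards [self_mem_nhdsWithin] with δ h using hδ δ h

theorem UW₁_le_minimalFlux {N : Seminorm ℝ (Space d)} {α : ℝ} {Ω : Set (Space d)}
    (hΩ : IsCompact Ω) {μ₀ μ₁ : Space d → ℝ} (hμ₀ : IsDensity Ω μ₀) (hμ₁ : IsDensity Ω μ₁) :
    UW₁ N α Ω μ₀ μ₁ ≤ minimalFlux N α Ω μ₀ μ₁ := by
  have m₀ := hμ₀.1.aestronglyMeasurable
  have m₁ := hμ₁.1.aestronglyMeasurable
  refine le_minimalFlux_of_forall_bumpPath hΩ (ρ₀ := m₀.mk μ₀) (ρ₁ := m₁.mk μ₁)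
    ⟨hμ₀.1.congr m₀.ae_eq_mk, ?_⟩ ⟨hμ₁.1.congr m₁.ae_eq_mk, ?_⟩
    m₀.stronglyMeasurable_mk.measurable m₁.stronglyMeasurable_mk.measurable m₀.ae_eq_mk.symm
    m₁.ae_eq_mk.symm fun δ v f h => ?_
  · filter_upwards [hμ₀.2, m₀.ae_eq_mk] with x hx hx'
    rwa [← hx']
  · filter_upwards [hμ₁.2, m₁.ae_eq_mk] with x hx hx'
    rwa [← hx']
  · exact (iInf_le _ _).trans ((iInf_le _ v).trans ((iInf_le _ f).trans (iInf_le _ h)))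

/-- Extension of the marginals by zero gives Borel functions that agree with them at every point of
`Ω`, so the path stays jointly continuous on `[0,1] × Ω`. Arbitrary almost everywhere
representatives would lose this. -/
theorem UW₁Continuous_le_minimalFlux {N : Seminorm ℝ (Space d)} {α : ℝ}
    {Ω : Set (Space d)} (hΩ : IsCompact Ω) {μ₀ μ₁ : Space d → ℝ} (hμ₀ : IsDensity Ω μ₀)
    (hμ₁ : IsDensity Ω μ₁) (hc₀ : ContinuousOn μ₀ Ω) (hc₁ : ContinuousOn μ₁ Ω) :
    UW₁Continuous N α Ω μ₀ μ₁ ≤ minimalFlux N α Ω μ₀ μ₁ := by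
  have hind : ∀ {ρ : Space d → ℝ}, ContinuousOn ρ Ω → Measurable (Ω.indicator ρ) := fun hρ => by
    classical
    rw [← piecewise_eq_indicator]
    exact hρ.measurable_piecewise continuousOn_const hΩ.measurableSet
  have heq : ∀ ρ : Space d → ℝ, Ω.indicator ρ =ᵐ[volume.restrict Ω] ρ := fun ρ =>
    indicator_ae_eq_restrict hΩ.measurableSet
  refine le_minimalFlux_of_forall_bumpPath hΩ (ρ₀ := Ω.indicator μ₀) (ρ₁ := Ω.indicator μ₁)
    ⟨hμ₀.1.congr (heq _).symm, ?_⟩ ⟨hμ₁.1.congr (heq _).symm, ?_⟩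
    (hind hc₀) (hind hc₁) (heq _) (heq _) fun δ v f h => ?_
  · filter_upwards [hμ₀.2, heq μ₀] with x hx hx'
    rwa [hx']
  · filter_upwards [hμ₁.2, heq μ₁] with x hx hx'
    rwa [hx']
  · refine (iInf_le _ _).trans ((iInf_le _ v).trans ((iInf_le _ f).trans ((iInf_le _ h).trans
      (iInf_le _ ?_))))
    have c₀ : ContinuousOn (Ω.indicator μ₀) Ω := hc₀.congr fun x hx => indicator_of_mem hx _
    have c₁ : ContinuousOn (Ω.indicator μ₁) Ω := hc₁.congr fun x hx => indicator_of_mem hx _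
    have hs : MapsTo (Prod.snd : ℝ × Space d → Space d) (Icc (0 : ℝ) 1 ×ˢ Ω) Ω := fun p hp => hp.2
    have d₀ := c₀.comp continuousOn_snd hs
    have d₁ := c₁.comp continuousOn_snd hs
    have hfst : ContinuousOn (Prod.fst : ℝ × Space d → ℝ) (Icc (0 : ℝ) 1 ×ˢ Ω) := continuousOn_fst
    exact (((continuousOn_const.sub hfst).mul d₀).add (hfst.mul d₁)).add
      (continuousOn_const.mul (hfst.mul (continuousOn_const.sub hfst)))

/-- The competitor has no flux and creates or destroys all of the difference in place. Besides
finiteness, this bound yields the constant `1 / α` for the potential. -/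
theorem minimalFlux_le_lintegral (N : Seminorm ℝ (Space d)) (α : ℝ) {Ω : Set (Space d)}
    {μ₀ μ₁ : Space d → ℝ} (hμ₀ : IntegrableOn μ₀ Ω) (hμ₁ : IntegrableOn μ₁ Ω) :
    minimalFlux N α Ω μ₀ μ₁
      ≤ ENNReal.ofReal (1 / α) * ∫⁻ x in Ω, ENNReal.ofReal |μ₁ x - μ₀ x| := by
  have h : IsFeasible Ω μ₀ μ₁ 0 (fun x => μ₁ x - μ₀ x) :=
    ⟨integrable_zero _ _ _, hμ₁.sub hμ₀, fun φ _ => by simp⟩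
  simpa [staticCost] using h.minimalFlux_le (N := N) (α := α)

/-! ### Lipschitz functions as test functions -/

section Mollification

variable {Φ : Space d → ℝ} {K : ℝ≥0}

/-- The mollification of a Lipschitz function can be differentiated under the convolution. -/
theorem hasFDerivAt_normed_convolution (hΦ : LipschitzWith K Φ) (ψ : ContDiffBump (0 : Space d))
    (x : Space d) :
    HasFDerivAt (convolution (ψ.normed volume) Φ (ContinuousLinearMap.lsmul ℝ ℝ) volume)
      (convolution (ψ.normed volume) (fderiv ℝ Φ) (ContinuousLinearMap.lsmul ℝ ℝ) volume x) x := by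
  have hψc : Continuous (ψ.normed volume) := ψ.continuous_normed
  have hψi : Integrable (ψ.normed volume) := ψ.integrable_normed
  unfold convolution
  simp only [ContinuousLinearMap.lsmul_apply]
  refine (hasFDerivAt_integral_of_dominated_loc_of_lip (s := univ)
    (bound := fun a => ψ.normed volume a * K) univ_mem (Eventually.of_forall fun y => ?_) ?_ ?_ ?_
    (hψi.mul_const _) ?_).2
  · have := hΦ.continuous
    exact Continuous.aestronglyMeasurable (by fun_prop)
  · have := hΦ.continuous
    exact Continuous.integrable_of_hasCompactSupport (by fun_prop)
      (ψ.hasCompactSupport_normed.smul_right)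
  · exact hψc.aestronglyMeasurable.smul
      ((measurable_fderiv ℝ Φ).comp (measurable_const.sub measurable_id)).aestronglyMeasurable
  · refine Eventually.of_forall fun a => LipschitzOnWith.of_dist_le_mul fun y _ z _ => ?_
    have h1 := hΦ.dist_le_mul (y - a) (z - a)
    rw [dist_sub_right] at h1
    have h0 : 0 ≤ ψ.normed volume a := ψ.nonneg_normed a
    rw [dist_smul₀, Real.norm_of_nonneg h0, Real.coe_nnabs,
      abs_of_nonneg (mul_nonneg h0 K.coe_nonneg), mul_assoc]
    exact mul_le_mul_of_nonneg_left h1 h0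
  -- Rademacher's theorem gives differentiability at almost every point, and `a ↦ x - a` preserves
  -- Lebesgue measure.
  · have hd := (Measure.measurePreserving_sub_left (volume : Measure (Space d)) x).quasiMeasurePreserving.ae
      (hΦ.ae_differentiableAt (μ := volume))
    filter_upwards [hd] with a ha
    have h1 : HasFDerivAt (fun y => Φ (y - a)) (fderiv ℝ Φ (x - a)) x :=
      ha.hasFDerivAt.comp x ((hasFDerivAt_id x).sub_const a)
    exact HasFDerivAt.const_smul (R := ℝ) h1 (ψ.normed volume a)

/-- The derivative of the mollification is an average of derivatives of norm at most `K` with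
weights of total mass one. -/
theorem norm_fderiv_normed_convolution_le (hΦ : LipschitzWith K Φ) (ψ : ContDiffBump (0 : Space d))
    (x : Space d) :
    ‖fderiv ℝ (convolution (ψ.normed volume) Φ (ContinuousLinearMap.lsmul ℝ ℝ) volume) x‖ ≤ K := by
  rw [(hasFDerivAt_normed_convolution hΦ ψ x).fderiv]
  have hψi : Integrable (ψ.normed volume) := ψ.integrable_normed
  refine (norm_integral_le_of_norm_le (hψi.mul_const (K : ℝ)) (Eventually.of_forall fun a => ?_)).trans
    (le_of_eq ?_)
  · rw [ContinuousLinearMap.lsmul_apply, norm_smul, Real.norm_of_nonneg (ψ.nonneg_normed a)]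
    exact mul_le_mul_of_nonneg_left (norm_fderiv_le_of_lipschitz ℝ hΦ) (ψ.nonneg_normed a)
  · rw [integral_mul_const, ψ.integral_normed, one_mul]

theorem locallyIntegrable_fderiv (hΦ : LipschitzWith K Φ) :
    LocallyIntegrable (fderiv ℝ Φ) (volume : Measure (Space d)) :=
  (locallyIntegrable_const (K : ℝ)).mono (measurable_fderiv ℝ Φ).aestronglyMeasurable
    (Eventually.of_forall fun x => by
      simpa using norm_fderiv_le_of_lipschitz ℝ (x₀ := x) hΦ)

theorem norm_gradient (φ : Space d → ℝ) (x : Space d) : ‖gradient φ x‖ = ‖fderiv ℝ φ x‖ :=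
  LinearIsometryEquiv.norm_map _ _

theorem measurable_gradient (φ : Space d → ℝ) : Measurable (gradient φ) :=
  (InnerProductSpace.toDual ℝ (Space d)).symm.continuous.measurable.comp (measurable_fderiv ℝ φ)

/-- The bumps of outer radius `1 / (n + 1)` used for mollification. -/
def mollifier (d n : ℕ) : ContDiffBump (0 : Space d) where
  rIn := 1 / (n + 1) / 2
  rOut := 1 / (n + 1)
  rIn_pos := by positivity
  rIn_lt_rOut := half_lt_self (by positivity)

/-- Lipschitz functions may be used as test functions in the static constraint. -/
theorem IsFeasible.integral_mul_eq_of_lipschitz {Ω : Set (Space d)} (hΩ : IsCompact Ω)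
    {μ₀ μ₁ : Space d → ℝ} {m : Space d → Space d} {c : Space d → ℝ}
    (hμ₀ : IntegrableOn μ₀ Ω) (hμ₁ : IntegrableOn μ₁ Ω) (h : IsFeasible Ω μ₀ μ₁ m c)
    (hΦ : LipschitzWith K Φ) :
    ∫ x in Ω, Φ x * (μ₁ x - μ₀ x - c x) = ∫ x in Ω, inner ℝ (gradient Φ x) (m x) := by
  set φ : ℕ → Space d → ℝ := fun n =>
    convolution ((mollifier d n).normed volume) Φ (ContinuousLinearMap.lsmul ℝ ℝ) volume with hφ
  have hsm : ∀ n, ContDiff ℝ ∞ (φ n) := fun n =>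
    (mollifier d n).hasCompactSupport_normed.contDiff_convolution_left _
      (mollifier d n).contDiff_normed hΦ.continuous.locallyIntegrable
  have hr : Tendsto (fun n => (mollifier d n).rOut) atTop (𝓝 0) :=
    tendsto_one_div_add_atTop_nhds_zero_nat
  have hlim : ∀ x, Tendsto (fun n => φ n x) atTop (𝓝 (Φ x)) := fun x =>
    ContDiffBump.convolution_tendsto_right_of_continuous hr hΦ.continuous x
  have hbd : ∀ n x, |φ n x| ≤ |Φ x| + K := by
    intro n x
    have hd : dist (φ n x) (Φ x) ≤ K := by
      refine ContDiffBump.dist_normed_convolution_le hΦ.continuous.aestronglyMeasurable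
        fun y hy => (hΦ.dist_le_mul y x).trans ?_
      have h1 : dist y x ≤ 1 := (Metric.mem_ball.1 hy).le.trans
        (by
          change (1 : ℝ) / (n + 1) ≤ 1
          exact (div_le_one (by positivity)).2 (by simp))
      simpa using mul_le_mul_of_nonneg_left h1 K.coe_nonneg
    rw [Real.dist_eq] at hd
    have := abs_sub_abs_le_abs_sub (φ n x) (Φ x)
    linarith
  have hglim : ∀ᵐ x ∂(volume : Measure (Space d)),
      Tendsto (fun n => gradient (φ n) x) atTop (𝓝 (gradient Φ x)) := by
    -- Lebesgue differentiation applied to `fderiv ℝ Φ`; `K := 2` bounds the ratio of outer to inner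
    -- radius of the bumps.
    have hae := ContDiffBump.ae_convolution_tendsto_right_of_locallyIntegrable
      (φ := mollifier d) (K := 2) hr (Eventually.of_forall fun n => by
        change (1 : ℝ) / (n + 1) ≤ 2 * (1 / (n + 1) / 2)
        linarith) (locallyIntegrable_fderiv hΦ)
    filter_upwards [hae] with x hx
    refine ((InnerProductSpace.toDual ℝ (Space d)).symm.continuous.tendsto _).comp
      (hx.congr fun n => ?_)
    exact (hasFDerivAt_normed_convolution hΦ (mollifier d n) x).fderiv.symm
  have hr0 : IntegrableOn (fun x => μ₁ x - μ₀ x - c x) Ω := (hμ₁.sub hμ₀).sub h.integrable_source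
  obtain ⟨C, hC⟩ := hΩ.exists_bound_of_continuousOn hΦ.continuous.continuousOn
  have l1 : Tendsto (fun n => ∫ x in Ω, φ n x * (μ₁ x - μ₀ x - c x)) atTop
      (𝓝 (∫ x in Ω, Φ x * (μ₁ x - μ₀ x - c x))) := by
    refine tendsto_integral_of_dominated_convergence (fun x => (C + K) * ‖μ₁ x - μ₀ x - c x‖)
      (fun n => (hsm n).continuous.aestronglyMeasurable.mul hr0.aestronglyMeasurable)
      (hr0.norm.const_mul _) (fun n => ?_) (Eventually.of_forall fun x => (hlim x).mul_const _)
    refine ae_restrict_of_forall_mem hΩ.measurableSet fun x hx => ?_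
    rw [norm_mul]
    refine mul_le_mul_of_nonneg_right ((hbd n x).trans ?_) (norm_nonneg _)
    linarith [hC x hx, Real.norm_eq_abs (Φ x)]
  have l2 : Tendsto (fun n => ∫ x in Ω, inner ℝ (gradient (φ n) x) (m x)) atTop
      (𝓝 (∫ x in Ω, inner ℝ (gradient Φ x) (m x))) := by
    refine tendsto_integral_of_dominated_convergence (fun x => K * ‖m x‖)
      (fun n => (measurable_gradient _).aestronglyMeasurable.inner
        h.integrable_flux.aestronglyMeasurable)
      (h.integrable_flux.norm.const_mul _) (fun n => Eventually.of_forall fun x => ?_) ?_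
    · refine (norm_inner_le_norm _ _).trans (mul_le_mul_of_nonneg_right ?_ (norm_nonneg _))
      rw [norm_gradient]
      exact norm_fderiv_normed_convolution_le hΦ _ x
    · filter_upwards [ae_restrict_of_ae hglim] with x hx
      exact hx.inner tendsto_const_nhds
  refine tendsto_nhds_unique l1 (l2.congr fun n => ?_)
  linarith [h.constraint (φ n) (hsm n)]

end Mollification

/-! ### Hahn–Banach for sublinear functions and the dual of `L¹` -/

/-- A sublinear function is supported at each point by a linear function below it. -/
theorem exists_linearMap_le_sublinear {E : Type*} [AddCommGroup E] [Module ℝ E] (p : E → ℝ)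
    (p_hom : ∀ c : ℝ, 0 < c → ∀ x, p (c • x) = c * p x) (p_add : ∀ x y, p (x + y) ≤ p x + p y)
    (x : E) : ∃ g : E →ₗ[ℝ] ℝ, g x = p x ∧ ∀ y, g y ≤ p y := by
  have p0 : p 0 = 0 := by
    have := p_hom 2 two_pos 0
    rw [smul_zero] at this
    linarith
  -- This makes `c • x ↦ c * p x` well defined on the line through `x`, including the case `x = 0`.
  have hx : ∀ c : ℝ, c • x = 0 → c • p x = 0 := by
    intro c hc
    rcases smul_eq_zero.1 hc with rfl | rfl
    · simp
    · simp [p0]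
  obtain ⟨g, hg, hle⟩ := exists_extension_of_le_sublinear
    (LinearPMap.mkSpanSingleton' (σ := RingHom.id ℝ) x (p x) hx) p p_hom p_add (by
      rintro ⟨y, hy⟩
      obtain ⟨c, rfl⟩ := Submodule.mem_span_singleton.1 hy
      rw [LinearPMap.mkSpanSingleton'_apply, RingHom.id_apply, smul_eq_mul]
      rcases lt_trichotomy c 0 with hc | rfl | hc
      -- For negative `c`, subadditivity gives `0 = p 0 ≤ p (c • x) + p (-c • x)`, which is the
      -- required lower bound on `p (c • x)`.
      · have h1 := p_add (c • x) ((-c) • x)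
        rw [← add_smul, add_neg_cancel, zero_smul, p0, p_hom (-c) (neg_pos.2 hc)] at h1
        simp only
        linarith
      · simp [p0]
      · exact (p_hom c hc x).ge)
  refine ⟨g, ?_, hle⟩
  have h := hg ⟨x, Submodule.mem_span_singleton_self x⟩
  exact h.trans (LinearPMap.mkSpanSingleton'_apply_self x (p x) hx _)

section Duality

variable {β : Type*} [MeasurableSpace β] {ν : Measure β} [IsFiniteMeasure ν]

/-- The inclusion of `L²` into `L¹` over a finite measure. -/
def LpTwoToLpOne (ν : Measure β) [IsFiniteMeasure ν] : Lp ℝ 2 ν →ₗ[ℝ] Lp ℝ 1 ν where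
  toFun f := ((Lp.memLp f).mono_exponent one_le_two).toLp f
  map_add' f g := MemLp.toLp_congr _
    (((Lp.memLp f).mono_exponent one_le_two).add ((Lp.memLp g).mono_exponent one_le_two))
    (Lp.coeFn_add f g)
  map_smul' r f := MemLp.toLp_congr _
    (((Lp.memLp f).mono_exponent one_le_two).const_smul r) (Lp.coeFn_smul r f)

theorem LpTwoToLpOne_indicatorConstLp {s : Set β} (hs : MeasurableSet s) (c : ℝ) :
    LpTwoToLpOne ν (indicatorConstLp 2 hs (measure_ne_top ν s) c)
      = indicatorConstLp 1 hs (measure_ne_top ν s) c :=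
  MemLp.toLp_congr ((Lp.memLp _).mono_exponent one_le_two)
    (memLp_indicator_const 1 hs c (Or.inr (measure_ne_top ν s))) indicatorConstLp_coeFn

theorem norm_LpTwoToLpOne_le (f : Lp ℝ 2 ν) :
    ‖LpTwoToLpOne ν f‖ ≤ (ν univ ^ (1 / 2 : ℝ)).toReal * ‖f‖ := by
  have h := eLpNorm_le_eLpNorm_mul_rpow_measure_univ (μ := ν) (p := 1) (q := 2) one_le_two
    (Lp.aestronglyMeasurable f)
  have e : (1 / (1 : ℝ≥0∞).toReal - 1 / (2 : ℝ≥0∞).toReal) = (1 / 2 : ℝ) := by norm_num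
  rw [e] at h
  rw [mul_comm, Lp.norm_def f, ← ENNReal.toReal_mul]
  refine (Lp.norm_toLp f ((Lp.memLp f).mono_exponent one_le_two)).trans_le (ENNReal.toReal_mono ?_ h)
  exact ENNReal.mul_ne_top (Lp.eLpNorm_ne_top f)
    (ENNReal.rpow_ne_top_of_nonneg (by norm_num) (measure_ne_top ν _))

/-- A bounded linear functional on `L¹` of a finite measure is given by a bounded function. -/
theorem exists_bounded_representation (ℓ : Lp ℝ 1 ν →ₗ[ℝ] ℝ) {C : ℝ}
    (hℓ : ∀ ρ, ℓ ρ ≤ C * ‖ρ‖) :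
    ∃ Φ : β → ℝ, Measurable Φ ∧ (∀ᵐ x ∂ν, |Φ x| ≤ C) ∧ ∀ ρ : Lp ℝ 1 ν, ℓ ρ = ∫ x, Φ x * ρ x ∂ν := by
  have habs : ∀ ρ, |ℓ ρ| ≤ C * ‖ρ‖ := fun ρ => by
    refine abs_le.2 ⟨?_, hℓ ρ⟩
    have := hℓ (-ρ)
    rw [map_neg, norm_neg] at this
    linarith
  have hC : ∀ f : Lp ℝ 2 ν, ‖(ℓ.comp (LpTwoToLpOne ν)) f‖
      ≤ |C| * (ν univ ^ (1 / 2 : ℝ)).toReal * ‖f‖ := fun f => by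
    rw [mul_assoc]
    refine (habs _).trans ((mul_le_mul_of_nonneg_right (le_abs_self C) (norm_nonneg _)).trans ?_)
    exact mul_le_mul_of_nonneg_left (norm_LpTwoToLpOne_le f) (abs_nonneg C)
  -- The measure is finite, so `ℓ` restricts to the Hilbert space `L²`, where Riesz's theorem
  -- supplies `Ψ`. Testing on indicators then bounds `Ψ` by `C`, and density of simple functions
  -- carries the formula back to `L¹`.
  set ℓ₂ : StrongDual ℝ (Lp ℝ 2 ν) := LinearMap.mkContinuous (ℓ.comp (LpTwoToLpOne ν)) _ hC
  set Ψ : Lp ℝ 2 ν := (InnerProductSpace.toDual ℝ (Lp ℝ 2 ν)).symm ℓ₂ with hΨ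
  have hΨi : Integrable Ψ ν := (Lp.memLp Ψ).integrable one_le_two
  have hind : ∀ (c : ℝ) {s : Set β} (hs : MeasurableSet s),
      ℓ (indicatorConstLp 1 hs (measure_ne_top ν s) c) = c * ∫ x in s, Ψ x ∂ν := by
    intro c s hs
    have h1 : inner ℝ Ψ (indicatorConstLp 2 hs (measure_ne_top ν s) c)
        = ℓ₂ (indicatorConstLp 2 hs (measure_ne_top ν s) c) :=
      InnerProductSpace.toDual_symm_apply
    rw [real_inner_comm, L2.inner_indicatorConstLp_eq_inner_setIntegral] at h1
    rw [← LpTwoToLpOne_indicatorConstLp hs c]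
    refine (show ℓ₂ _ = _ from h1.symm.trans ?_)
    simp [mul_comm]
  have hnorm : ∀ {s : Set β} (hs : MeasurableSet s),
      ‖indicatorConstLp 1 hs (measure_ne_top ν s) (1 : ℝ)‖ = ν.real s := fun hs => by
    rw [norm_indicatorConstLp one_ne_zero ENNReal.one_ne_top]
    simp
  have hup : ∀ᵐ x ∂ν, Ψ x ≤ C := by
    refine ae_le_of_forall_setIntegral_le hΨi (integrable_const C) fun s hs _ => ?_
    have h1 := habs (indicatorConstLp 1 hs (measure_ne_top ν s) 1)
    rw [hind, hnorm, one_mul] at h1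
    simpa [mul_comm] using (le_abs_self _).trans h1
  have hlow : ∀ᵐ x ∂ν, -C ≤ Ψ x := by
    refine ae_le_of_forall_setIntegral_le (integrable_const (-C)) hΨi fun s hs _ => ?_
    have h1 := habs (indicatorConstLp 1 hs (measure_ne_top ν s) 1)
    rw [hind, hnorm, one_mul] at h1
    have h2 := (abs_le.1 h1).1
    simp only [integral_const, smul_eq_mul, measureReal_restrict_apply_univ]
    linarith
  have hbd : ∀ᵐ x ∂ν, |Ψ x| ≤ C := by
    filter_upwards [hup, hlow] with x h1 h2 using abs_le.2 ⟨h2, h1⟩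
  have hmul : ∀ {ρ : β → ℝ}, Integrable ρ ν → Integrable (fun x => Ψ x * ρ x) ν := fun hρ =>
    hρ.bdd_mul hΨi.aestronglyMeasurable hbd
  have hrep : ∀ ρ : Lp ℝ 1 ν, ℓ ρ = ∫ x, Ψ x * ρ x ∂ν := by
    intro ρ
    induction ρ using Lp.induction ENNReal.one_ne_top with
    | @indicatorConst c s hs hμs =>
      rw [Lp.simpleFunc.coe_indicatorConst, hind, ← integral_const_mul, ← integral_indicator hs]
      refine integral_congr_ae ?_
      filter_upwards [indicatorConstLp_coeFn (p := 1) (hs := hs) (hμs := hμs.ne) (c := c)] with x hx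
      rw [hx]
      by_cases h : x ∈ s <;> simp [h, mul_comm]
    | add hf hg _ h1 h2 =>
      rw [map_add, h1, h2, ← integral_add (hmul (L1.integrable_coeFn _))
        (hmul (L1.integrable_coeFn _))]
      refine integral_congr_ae ?_
      filter_upwards [Lp.coeFn_add (hf.toLp _) (hg.toLp _)] with x hx
      rw [hx, Pi.add_apply, mul_add]
    | isClosed =>
      refine isClosed_eq ?_ ?_
      · exact (LinearMap.mkContinuous ℓ C habs).continuous
      · refine (LipschitzWith.of_dist_le_mul (K := C.toNNReal) fun f g => ?_).continuous
        rw [Real.dist_eq, dist_eq_norm, ← integral_sub (hmul (L1.integrable_coeFn _))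
          (hmul (L1.integrable_coeFn _)), L1.norm_eq_integral_norm, ← integral_const_mul,
          ← Real.norm_eq_abs]
        refine norm_integral_le_of_norm_le ((L1.integrable_coeFn (f - g)).norm.const_mul _) ?_
        filter_upwards [Lp.coeFn_sub f g, hbd] with x hx hb
        rw [hx, Pi.sub_apply, ← mul_sub, norm_mul, Real.norm_eq_abs]
        exact mul_le_mul_of_nonneg_right (hb.trans (Real.le_coe_toNNReal C)) (norm_nonneg _)
  have hm := Lp.aestronglyMeasurable Ψ
  refine ⟨hm.mk Ψ, hm.stronglyMeasurable_mk.measurable, ?_, fun ρ => ?_⟩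
  · filter_upwards [hbd, hm.ae_eq_mk] with x h1 h2
    rwa [← h2]
  · rw [hrep]
    refine integral_congr_ae ?_
    filter_upwards [hm.ae_eq_mk] with x hx
    rw [← hx]

end Duality

/-! ### The static value as a sublinear function of the difference of the marginals -/

section Value

variable {N : Seminorm ℝ (Space d)} {α : ℝ} {Ω : Set (Space d)}

theorem isFeasible_sub_iff {μ₀ μ₁ : Space d → ℝ} {m : Space d → Space d} {c : Space d → ℝ} :
    IsFeasible Ω 0 (μ₁ - μ₀) m c ↔ IsFeasible Ω μ₀ μ₁ m c := by
  refine ⟨fun h => ⟨h.1, h.2, fun φ hφ => ?_⟩, fun h => ⟨h.1, h.2, fun φ hφ => ?_⟩⟩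
  · simpa using h.3 φ hφ
  · simpa using h.3 φ hφ

theorem minimalFlux_sub (μ₀ μ₁ : Space d → ℝ) :
    minimalFlux N α Ω 0 (μ₁ - μ₀) = minimalFlux N α Ω μ₀ μ₁ := by
  simp only [minimalFlux, isFeasible_sub_iff]

theorem IsFeasible.congr_terminal {μ₀ ρ ρ' : Space d → ℝ} {m : Space d → Space d}
    {c : Space d → ℝ} (hρ : ρ =ᵐ[volume.restrict Ω] ρ') (h : IsFeasible Ω μ₀ ρ m c) :
    IsFeasible Ω μ₀ ρ' m c := by
  refine ⟨h.1, h.2, fun φ hφ => ?_⟩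
  rw [← h.3 φ hφ]
  congr 1
  refine integral_congr_ae ?_
  filter_upwards [hρ] with x hx
  rw [hx]

theorem minimalFlux_congr {μ₀ ρ ρ' : Space d → ℝ} (hρ : ρ =ᵐ[volume.restrict Ω] ρ') :
    minimalFlux N α Ω μ₀ ρ = minimalFlux N α Ω μ₀ ρ' := by
  have e : ∀ m c, IsFeasible Ω μ₀ ρ m c ↔ IsFeasible Ω μ₀ ρ' m c := fun m c =>
    ⟨fun h => h.congr_terminal hρ, fun h => h.congr_terminal hρ.symm⟩
  simp only [minimalFlux, e]

theorem IsFeasible.add (hΩ : IsCompact Ω) {ρ ρ' : Space d → ℝ} {m m' : Space d → Space d}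
    {c c' : Space d → ℝ} (hρ : IntegrableOn ρ Ω) (hρ' : IntegrableOn ρ' Ω)
    (h : IsFeasible Ω 0 ρ m c) (h' : IsFeasible Ω 0 ρ' m' c') :
    IsFeasible Ω 0 (ρ + ρ') (m + m') (c + c') := by
  refine ⟨h.1.add h'.1, h.2.add h'.2, fun φ hφ => ?_⟩
  have hc := hφ.continuous.continuousOn (s := Ω)
  have i1 : IntegrableOn (fun x => φ x * (ρ x - (0 : Space d → ℝ) x - c x)) Ω :=
    ((hρ.sub (integrable_zero _ _ _)).sub h.2).continuousOn_mul hc hΩ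
  have i2 : IntegrableOn (fun x => φ x * (ρ' x - (0 : Space d → ℝ) x - c' x)) Ω :=
    ((hρ'.sub (integrable_zero _ _ _)).sub h'.2).continuousOn_mul hc hΩ
  have j1 := integrableOn_inner_of_continuous hΩ (continuous_gradient hφ) h.1
  have j2 := integrableOn_inner_of_continuous hΩ (continuous_gradient hφ) h'.1
  have e1 : ∫ x in Ω, φ x * ((ρ + ρ') x - (0 : Space d → ℝ) x - (c + c') x)
      = (∫ x in Ω, φ x * (ρ x - (0 : Space d → ℝ) x - c x))
        + ∫ x in Ω, φ x * (ρ' x - (0 : Space d → ℝ) x - c' x) := by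
    rw [← integral_add i1 i2]
    congr 1 with x
    simp only [Pi.add_apply, Pi.zero_apply]
    ring
  have e2 : ∫ x in Ω, inner ℝ (gradient φ x) ((m + m') x)
      = (∫ x in Ω, inner ℝ (gradient φ x) (m x)) + ∫ x in Ω, inner ℝ (gradient φ x) (m' x) := by
    rw [← integral_add j1 j2]
    simp only [Pi.add_apply, inner_add_right]
  rw [e1, e2]
  linarith [h.3 φ hφ, h'.3 φ hφ]

theorem IsFeasible.const_smul {ρ : Space d → ℝ} {m : Space d → Space d}
    {c : Space d → ℝ} (h : IsFeasible Ω 0 ρ m c) (r : ℝ) :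
    IsFeasible Ω 0 (r • ρ) (r • m) (r • c) := by
  refine ⟨h.1.smul r, h.2.smul r, fun φ hφ => ?_⟩
  have e1 : ∀ x, φ x * ((r • ρ) x - (0 : Space d → ℝ) x - (r • c) x)
      = r * (φ x * (ρ x - (0 : Space d → ℝ) x - c x)) := fun x => by
    simp only [Pi.smul_apply, smul_eq_mul, Pi.zero_apply]
    ring
  have e2 : ∀ x, inner ℝ (gradient φ x) ((r • m) x) = r * inner ℝ (gradient φ x) (m x) :=
    fun x => by rw [Pi.smul_apply, inner_smul_right]
  simp only [e1, e2, integral_const_mul, ← mul_sub, h.3 φ hφ, mul_zero]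

theorem staticCost_add_le {m m' : Space d → Space d} {c c' : Space d → ℝ}
    (hm : IntegrableOn m Ω) (hc : IntegrableOn c Ω) :
    staticCost N α Ω (m + m') (c + c') ≤ staticCost N α Ω m c + staticCost N α Ω m' c' := by
  have h1 : ∫⁻ x in Ω, ENNReal.ofReal (N ((m + m') x))
      ≤ (∫⁻ x in Ω, ENNReal.ofReal (N (m x))) + ∫⁻ x in Ω, ENNReal.ofReal (N (m' x)) := by
    rw [← lintegral_add_left' (integrable_seminorm_comp N hm).aemeasurable.ennreal_ofReal]
    refine lintegral_mono fun x => ?_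
    rw [← ENNReal.ofReal_add (apply_nonneg N _) (apply_nonneg N _)]
    exact ENNReal.ofReal_le_ofReal (map_add_le_add N _ _)
  have h2 : ∫⁻ x in Ω, ENNReal.ofReal |(c + c') x|
      ≤ (∫⁻ x in Ω, ENNReal.ofReal |c x|) + ∫⁻ x in Ω, ENNReal.ofReal |c' x| := by
    rw [← lintegral_add_left' hc.abs.aemeasurable.ennreal_ofReal]
    refine lintegral_mono fun x => ?_
    rw [← ENNReal.ofReal_add (abs_nonneg _) (abs_nonneg _)]
    exact ENNReal.ofReal_le_ofReal (abs_add_le _ _)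
  unfold staticCost
  refine (add_le_add h1 (mul_le_mul_right h2 _)).trans (le_of_eq ?_)
  ring

theorem staticCost_smul {m : Space d → Space d} {c : Space d → ℝ} {r : ℝ} (hr : 0 ≤ r) :
    staticCost N α Ω (r • m) (r • c) = ENNReal.ofReal r * staticCost N α Ω m c := by
  have h1 : ∀ x, ENNReal.ofReal (N ((r • m) x)) = ENNReal.ofReal r * ENNReal.ofReal (N (m x)) :=
    fun x => by rw [← ENNReal.ofReal_mul hr, Pi.smul_apply, map_smul_eq_mul, Real.norm_of_nonneg hr]
  have h2 : ∀ x, ENNReal.ofReal |(r • c) x| = ENNReal.ofReal r * ENNReal.ofReal |c x| :=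
    fun x => by rw [← ENNReal.ofReal_mul hr, Pi.smul_apply, smul_eq_mul, abs_mul, abs_of_nonneg hr]
  unfold staticCost
  simp only [h1, h2, lintegral_const_mul' _ _ ENNReal.ofReal_ne_top]
  ring

theorem minimalFlux_add_le (hΩ : IsCompact Ω) {ρ ρ' : Space d → ℝ} (hρ : IntegrableOn ρ Ω)
    (hρ' : IntegrableOn ρ' Ω) :
    minimalFlux N α Ω 0 (ρ + ρ') ≤ minimalFlux N α Ω 0 ρ + minimalFlux N α Ω 0 ρ' := by
  rw [minimalFlux.eq_1 N α Ω 0 ρ, minimalFlux.eq_1 N α Ω 0 ρ']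
  simp only [ENNReal.iInf_add, ENNReal.add_iInf]
  exact le_iInf fun m' => le_iInf fun c' => le_iInf fun h' => le_iInf fun m => le_iInf fun c =>
    le_iInf fun h => (h.add hΩ hρ hρ' h').minimalFlux_le.trans (staticCost_add_le h.1 h.2)

theorem minimalFlux_smul_le {ρ : Space d → ℝ} {r : ℝ} (hr : 0 < r) :
    minimalFlux N α Ω 0 (r • ρ) ≤ ENNReal.ofReal r * minimalFlux N α Ω 0 ρ := by
  rw [minimalFlux.eq_1 N α Ω 0 ρ]
  have h0 : ENNReal.ofReal r ≠ 0 := (ENNReal.ofReal_pos.2 hr).ne'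
  simp only [ENNReal.mul_iInf_of_ne h0 ENNReal.ofReal_ne_top]
  exact le_iInf fun m => le_iInf fun c => le_iInf fun h =>
    (h.const_smul r).minimalFlux_le.trans (staticCost_smul hr.le).le

theorem minimalFlux_smul {ρ : Space d → ℝ} {r : ℝ} (hr : 0 < r) :
    minimalFlux N α Ω 0 (r • ρ) = ENNReal.ofReal r * minimalFlux N α Ω 0 ρ := by
  refine le_antisymm (minimalFlux_smul_le hr) ?_
  -- The reverse inequality is the same one applied to `r • ρ` with factor `r⁻¹`.
  have h := minimalFlux_smul_le (N := N) (α := α) (Ω := Ω) (ρ := r • ρ) (inv_pos.2 hr)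
  rw [inv_smul_smul₀ hr.ne'] at h
  refine (mul_le_mul_right h _).trans ?_
  rw [← mul_assoc, ← ENNReal.ofReal_mul hr.le, mul_inv_cancel₀ hr.ne', ENNReal.ofReal_one, one_mul]

theorem minimalFlux_ne_top {μ₀ μ₁ : Space d → ℝ} (h₀ : IntegrableOn μ₀ Ω) (h₁ : IntegrableOn μ₁ Ω) :
    minimalFlux N α Ω μ₀ μ₁ ≠ ⊤ := by
  refine ne_top_of_le_ne_top (ENNReal.mul_ne_top ENNReal.ofReal_ne_top ?_)
    (minimalFlux_le_lintegral N α h₀ h₁)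
  have h := (hasFiniteIntegral_iff_norm _).1 (h₁.sub h₀).2
  exact h.ne

/-- Hahn–Banach and Riesz give a bounded potential supporting the value at the given marginals. -/
theorem exists_supporting_potential (N : Seminorm ℝ (Space d)) (hα : 0 < α) (hΩ : IsCompact Ω)
    {μ₀ μ₁ : Space d → ℝ} (h₀ : IntegrableOn μ₀ Ω) (h₁ : IntegrableOn μ₁ Ω) :
    ∃ Φ : Space d → ℝ, Measurable Φ ∧ (∀ x, |Φ x| ≤ 1 / α) ∧
      ∫ x in Ω, Φ x * (μ₁ x - μ₀ x) = (minimalFlux N α Ω μ₀ μ₁).toReal ∧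
      ∀ ρ : Space d → ℝ, IntegrableOn ρ Ω →
        ∫ x in Ω, Φ x * ρ x ≤ (minimalFlux N α Ω 0 ρ).toReal := by
  have : IsFiniteMeasure ((volume : Measure (Space d)).restrict Ω) :=
    ⟨by simpa using hΩ.measure_lt_top⟩
  set p : Lp ℝ 1 ((volume : Measure (Space d)).restrict Ω) → ℝ :=
    fun ρ => (minimalFlux N α Ω 0 ρ).toReal with hp
  have h0 : IntegrableOn (0 : Space d → ℝ) Ω := integrable_zero _ _ _
  have hi := fun ρ : Lp ℝ 1 ((volume : Measure (Space d)).restrict Ω) => L1.integrable_coeFn ρ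
  have hr : IntegrableOn (μ₁ - μ₀) Ω := h₁.sub h₀
  obtain ⟨ℓ, hℓ, hle⟩ := exists_linearMap_le_sublinear p
    (fun r hr ρ => by
      simp only [hp]
      rw [minimalFlux_congr (Lp.coeFn_smul r ρ), minimalFlux_smul hr, ENNReal.toReal_mul,
        ENNReal.toReal_ofReal hr.le])
    (fun ρ ρ' => by
      simp only [hp]
      rw [minimalFlux_congr (Lp.coeFn_add ρ ρ'),
        ← ENNReal.toReal_add (minimalFlux_ne_top h0 (hi ρ)) (minimalFlux_ne_top h0 (hi ρ'))]
      exact ENNReal.toReal_mono (ENNReal.add_ne_top.2 ⟨minimalFlux_ne_top h0 (hi ρ),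
        minimalFlux_ne_top h0 (hi ρ')⟩) (minimalFlux_add_le hΩ (hi ρ) (hi ρ')))
    (hr.toL1 (μ₁ - μ₀))
  obtain ⟨Φ₀, hΦ₀m, hΦ₀b, hΦ₀⟩ := exists_bounded_representation ℓ (C := 1 / α) fun ρ => by
    refine (hle ρ).trans ?_
    have h := minimalFlux_le_lintegral N α h0 (hi ρ)
    have e : ∫⁻ x in Ω, ENNReal.ofReal |ρ x - (0 : Space d → ℝ) x| = ENNReal.ofReal ‖ρ‖ := by
      rw [L1.norm_eq_integral_norm, ofReal_integral_eq_lintegral_ofReal (hi ρ).norm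
        (Eventually.of_forall fun _ => norm_nonneg _)]
      simp
    rw [e, ← ENNReal.ofReal_mul (by positivity)] at h
    exact ENNReal.toReal_le_of_le_ofReal (by positivity) h
  have hα' : 0 ≤ 1 / α := by positivity
  -- Truncation changes `Φ₀` only on a null set of `Ω` and makes the bound hold at every point.
  set Φ : Space d → ℝ := fun x => max (-(1 / α)) (min (1 / α) (Φ₀ x)) with hΦdef
  have hΦ : ∀ ρ : Lp ℝ 1 ((volume : Measure (Space d)).restrict Ω), ℓ ρ = ∫ x in Ω, Φ x * ρ x := by
    intro ρ
    rw [hΦ₀]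
    refine integral_congr_ae ?_
    filter_upwards [hΦ₀b] with x hx
    rw [hΦdef]
    simp only [min_eq_right (abs_le.1 hx).2, max_eq_right (abs_le.1 hx).1]
  refine ⟨Φ, by fun_prop, fun x => abs_le.2 ⟨le_max_left _ _, max_le (by linarith)
    (min_le_left _ _)⟩, ?_, fun ρ hρ => ?_⟩
  · have e := hr.coeFn_toL1
    rw [hΦ] at hℓ
    simp only [hp] at hℓ
    rw [minimalFlux_congr e, minimalFlux_sub] at hℓ
    rw [← hℓ]
    refine integral_congr_ae ?_
    filter_upwards [e] with x hx
    rw [hx, Pi.sub_apply]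
  · have h := hle (hρ.toL1 ρ)
    have e := hρ.coeFn_toL1
    rw [hΦ] at h
    simp only [hp] at h
    rw [minimalFlux_congr e] at h
    refine le_trans (le_of_eq ?_) h
    refine integral_congr_ae ?_
    filter_upwards [e] with x hx
    rw [hx]

end Value

/-! ### Translating mass inside a convex set, and the resulting Lipschitz bound -/

section Transport

variable {N : Seminorm ℝ (Space d)} {α : ℝ} {Ω A : Set (Space d)} {h : Space d}

/-- Each time slice is a translate of the same indicator, so its integral does not depend on time.
-/
theorem integrable_indicator_sub_smul (hA : MeasurableSet A) (hAfin : volume A ≠ ⊤) :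
    Integrable (fun p : ℝ × Space d => A.indicator (fun _ => (1 : ℝ)) (p.2 - p.1 • h))
      (((volume : Measure ℝ).restrict (Icc 0 1)).prod volume) := by
  have hχ : Integrable (A.indicator (fun _ => (1 : ℝ))) (volume : Measure (Space d)) :=
    (integrable_indicator_iff hA).2 (integrableOn_const hAfin)
  have hχm : Measurable (A.indicator (fun _ => (1 : ℝ))) := measurable_const.indicator hA
  have hm : Measurable fun p : ℝ × Space d => A.indicator (fun _ => (1 : ℝ)) (p.2 - p.1 • h) :=
    hχm.comp (by fun_prop)
  refine (integrable_prod_iff hm.aestronglyMeasurable).2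
    ⟨Eventually.of_forall fun t => hχ.comp_sub_right (t • h), ?_⟩
  have e : ∀ t : ℝ, ∫ z, ‖A.indicator (fun _ => (1 : ℝ)) (z - t • h)‖
      = ∫ z, ‖A.indicator (fun _ => (1 : ℝ)) z‖ := fun t =>
    integral_sub_right_eq_self (fun z => ‖A.indicator (fun _ => (1 : ℝ)) z‖) (t • h)
  simp only [e]
  exact integrable_const _

/-- The time spent at `z` by the mass that starts uniformly distributed on `A` and is translated
by `h` in unit time. -/
def translationOccupation (A : Set (Space d)) (h z : Space d) : ℝ :=
  ∫ t in Icc (0 : ℝ) 1, A.indicator (fun _ => (1 : ℝ)) (z - t • h)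

theorem translationOccupation_nonneg (z : Space d) : 0 ≤ translationOccupation A h z :=
  integral_nonneg fun _ => indicator_nonneg (fun _ _ => zero_le_one) _

theorem integrable_translationOccupation (hA : MeasurableSet A) (hAfin : volume A ≠ ⊤) :
    Integrable (translationOccupation A h) :=
  (integrable_indicator_sub_smul hA hAfin).integral_prod_right

theorem integral_translationOccupation (hA : MeasurableSet A) (hAfin : volume A ≠ ⊤) :
    ∫ z, translationOccupation A h z = volume.real A := by
  have e := integral_prod_symm _ (integrable_indicator_sub_smul (h := h) hA hAfin)
  rw [integral_prod _ (integrable_indicator_sub_smul hA hAfin)] at e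
  refine e.symm.trans ?_
  have e' : ∀ t : ℝ, ∫ z, A.indicator (fun _ => (1 : ℝ)) (z - t • h) = volume.real A := fun t => by
    rw [integral_sub_right_eq_self (A.indicator (fun _ => (1 : ℝ))) (t • h),
      integral_indicator_const _ hA, smul_eq_mul, mul_one]
  simp [e']

theorem mem_of_convex_segment (hΩ : Convex ℝ Ω) {z : Space d} (hz : z ∈ Ω) (hzh : z + h ∈ Ω) {t : ℝ}
    (ht : t ∈ Icc (0 : ℝ) 1) : z + t • h ∈ Ω := by
  have := hΩ hz hzh (sub_nonneg.2 ht.2) ht.1 (by ring)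
  convert this using 1
  module

/-- Translating the uniform mass on `A` by `h` inside `Ω` is feasible. -/
theorem isFeasible_translation (hΩ : IsCompact Ω) (hΩc : Convex ℝ Ω) (hA : MeasurableSet A)
    (hA₀ : A ⊆ Ω) (hA₁ : ∀ z ∈ A, z + h ∈ Ω) :
    IsFeasible Ω 0 (fun z => A.indicator (fun _ => (1 : ℝ)) (z - h) - A.indicator (fun _ => 1) z)
      (fun z => translationOccupation A h z • h) 0 := by
  set χ : Space d → ℝ := A.indicator (fun _ => (1 : ℝ)) with hχ
  have hAfin : volume A ≠ ⊤ := ((measure_mono hA₀).trans_lt hΩ.measure_lt_top).ne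
  have hχi : Integrable χ := (integrable_indicator_iff hA).2 (integrableOn_const hAfin)
  refine ⟨((integrable_translationOccupation hA hAfin).smul_const h).integrableOn,
    integrable_zero _ _ _, fun φ hφ => ?_⟩
  have hχφ : ∀ {g : Space d → ℝ}, Continuous g → Integrable fun z => χ z * g z := fun {g} hg => by
    have e : (fun z => χ z * g z) = A.indicator g := by
      ext z
      by_cases hz : z ∈ A <;> simp [hχ, hz]
    rw [e, integrable_indicator_iff hA]
    exact (hg.continuousOn.integrableOn_compact hΩ).mono_set hA₀
  have hdc : Continuous fun z => fderiv ℝ φ z h :=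
    (hφ.continuous_fderiv (by simp)).clm_apply continuous_const
  -- The cutoff to `Ω` makes the directional derivative globally bounded for Fubini. By convexity
  -- the segments from `z ∈ A` to `z + h` stay in `Ω`, so the cutoff is invisible along them.
  set G : Space d → ℝ := Ω.indicator fun z => fderiv ℝ φ z h with hG
  have hGm : Measurable G := hdc.measurable.indicator hΩ.measurableSet
  obtain ⟨C, hC⟩ := hΩ.exists_bound_of_continuousOn hdc.continuousOn
  have hGb : ∀ z, ‖G z‖ ≤ max C 0 := fun z => by
    by_cases hz : z ∈ Ω
    · simpa [hG, hz] using Or.inl (hC z hz)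
    · simp [hG, hz]
  have lhs : ∫ z in Ω, inner ℝ (gradient φ z) (translationOccupation A h z • h)
      = ∫ z, χ z * (φ (z + h) - φ z) := by
    have e1 : ∫ z in Ω, inner ℝ (gradient φ z) (translationOccupation A h z • h)
        = ∫ z, G z * translationOccupation A h z := by
      rw [← integral_indicator hΩ.measurableSet]
      congr 1 with z
      by_cases hz : z ∈ Ω
      · simp [hG, hz, inner_smul_right, inner_gradient_left, mul_comm]
      · simp [hG, hz]
    have i1 : Integrable (fun p : ℝ × Space d => G p.2 * χ (p.2 - p.1 • h))
        (((volume : Measure ℝ).restrict (Icc 0 1)).prod volume) :=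
      (integrable_indicator_sub_smul hA hAfin).bdd_mul
        (hGm.comp measurable_snd).aestronglyMeasurable (Eventually.of_forall fun p => hGb p.2)
    have i2 : Integrable (fun p : ℝ × Space d => G (p.2 + p.1 • h) * χ p.2)
        (((volume : Measure ℝ).restrict (Icc 0 1)).prod volume) :=
      (hχi.comp_snd _).bdd_mul
        (hGm.comp (by fun_prop : Measurable fun p : ℝ × Space d => p.2 + p.1 • h)).aestronglyMeasurable
        (Eventually.of_forall fun p => hGb _)
    have e2 : ∫ z, G z * translationOccupation A h z
        = ∫ z, ∫ t in Icc (0 : ℝ) 1, G z * χ (z - t • h) := by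
      simp only [integral_const_mul]
      rfl
    -- The substitution `z ↦ z + t • h` moves the translation from the indicator to the derivative,
    -- which can then be integrated in `t` by the fundamental theorem of calculus.
    have e3 : ∫ t in Icc (0 : ℝ) 1, ∫ z, G z * χ (z - t • h)
        = ∫ t in Icc (0 : ℝ) 1, ∫ z, G (z + t • h) * χ z := by
      congr 1 with t
      rw [← integral_sub_right_eq_self (fun z => G (z + t • h) * χ z) (t • h)]
      simp
    rw [e1, e2, ← integral_prod_symm _ i1, integral_prod _ i1]
    simp only []
    rw [e3, ← integral_prod _ i2, integral_prod_symm _ i2]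
    congr 1 with z
    simp only [integral_mul_const]
    rw [mul_comm]
    by_cases hz : z ∈ A
    · congr 1
      have e4 : ∫ t in Icc (0 : ℝ) 1, G (z + t • h)
          = ∫ t in Icc (0 : ℝ) 1, fderiv ℝ φ (z + t • h) h := by
        refine setIntegral_congr_fun measurableSet_Icc fun t ht => ?_
        simp [hG, mem_of_convex_segment hΩc (hA₀ hz) (hA₁ z hz) ht]
      have hd : ∀ t : ℝ, HasDerivAt (fun t : ℝ => φ (z + t • h)) (fderiv ℝ φ (z + t • h) h) t := by
        intro t
        have h1 : HasDerivAt (fun t : ℝ => z + t • h) h t := by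
          simpa using ((hasDerivAt_id t).smul_const h).const_add z
        exact (hφ.differentiable (by simp) _).hasFDerivAt.comp_hasDerivAt t h1
      have hft := intervalIntegral.integral_eq_sub_of_hasDerivAt (fun t _ => hd t)
        ((hdc.comp (by fun_prop : Continuous fun t : ℝ => z + t • h)).intervalIntegrable 0 1)
      rw [intervalIntegral.integral_of_le zero_le_one, ← integral_Icc_eq_integral_Ioc] at hft
      rw [e4]
      simpa using hft
    · simp [hχ, hz]
  have rhs : ∫ z in Ω, φ z * (χ (z - h) - χ z - (0 : Space d → ℝ) z - (0 : Space d → ℝ) z)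
      = ∫ z, χ z * (φ (z + h) - φ z) := by
    have hz0 : ∀ z, z ∉ Ω → φ z * (χ (z - h) - χ z) = 0 := fun z hz => by
      have h1 : z ∉ A := fun hzA => hz (hA₀ hzA)
      have h2 : z - h ∉ A := fun hzA => hz (by simpa using hA₁ _ hzA)
      simp [hχ, h1, h2]
    simp only [Pi.zero_apply, sub_zero]
    rw [setIntegral_eq_integral_of_forall_compl_eq_zero hz0]
    have j1 := hχφ (g := fun z => φ (z + h)) (by have := hφ.continuous; fun_prop)
    have j2 := hχφ hφ.continuous
    have j1' : Integrable fun z => χ (z - h) * φ z := by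
      simpa using j1.comp_sub_right h
    have e5 : ∫ z, χ z * φ (z + h) = ∫ z, χ (z - h) * φ z := by
      rw [← integral_sub_right_eq_self (fun z => χ z * φ (z + h)) h]
      simp
    calc ∫ z, φ z * (χ (z - h) - χ z) = ∫ z, (χ (z - h) * φ z - χ z * φ z) := by
          congr 1 with z
          ring
      _ = _ := by
          rw [integral_sub j1' j2, ← e5, ← integral_sub j1 j2]
          simp only [mul_sub]
  have rhs' : ∫ z in Ω, φ z * (χ (z - h) - A.indicator (fun _ => 1) z - (0 : Space d → ℝ) z
      - (0 : Space d → ℝ) z) = ∫ z, χ z * (φ (z + h) - φ z) := rhs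
  rw [lhs, rhs', sub_self]

/-- The flux is the occupation time multiplied by `h`, and the occupation time has total integral
`volume.real A`. -/
theorem minimalFlux_translation_le (hΩ : IsCompact Ω) (hΩc : Convex ℝ Ω) (hA : MeasurableSet A)
    (hA₀ : A ⊆ Ω) (hA₁ : ∀ z ∈ A, z + h ∈ Ω) :
    minimalFlux N α Ω 0
        (fun z => A.indicator (fun _ => (1 : ℝ)) (z - h) - A.indicator (fun _ => 1) z)
      ≤ ENNReal.ofReal (N h * volume.real A) := by
  have hAfin : volume A ≠ ⊤ := ((measure_mono hA₀).trans_lt hΩ.measure_lt_top).ne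
  refine (isFeasible_translation hΩ hΩc hA hA₀ hA₁).minimalFlux_le.trans ?_
  have e : ∀ z, ENNReal.ofReal (N (translationOccupation A h z • h))
      = ENNReal.ofReal (N h) * ENNReal.ofReal (translationOccupation A h z) := fun z => by
    rw [← ENNReal.ofReal_mul (apply_nonneg N h), map_smul_eq_mul,
      Real.norm_of_nonneg (translationOccupation_nonneg z), mul_comm]
  simp only [staticCost, e, Pi.zero_apply, abs_zero, ENNReal.ofReal_zero, lintegral_zero, mul_zero,
    add_zero]
  rw [lintegral_const_mul' _ _ ENNReal.ofReal_ne_top, ENNReal.ofReal_mul (apply_nonneg N h)]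
  refine mul_le_mul_right ((setLIntegral_le_lintegral Ω _).trans (le_of_eq ?_)) _
  rw [← integral_translationOccupation (h := h) hA hAfin,
    ofReal_integral_eq_lintegral_ofReal (integrable_translationOccupation hA hAfin)
      (Eventually.of_forall fun _ => translationOccupation_nonneg _)]

/-- A potential supporting the value satisfies the Lipschitz bound along almost every translate. -/
theorem ae_le_add_of_supporting (hΩ : IsCompact Ω) (hΩc : Convex ℝ Ω) {Φ : Space d → ℝ} {C : ℝ}
    (hΦ : Measurable Φ) (hΦC : ∀ x, |Φ x| ≤ C)
    (hsupp : ∀ ρ : Space d → ℝ, IntegrableOn ρ Ω →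
      ∫ x in Ω, Φ x * ρ x ≤ (minimalFlux N α Ω 0 ρ).toReal) (h : Space d) :
    ∀ᵐ z, z ∈ Ω → z + h ∈ Ω → Φ (z + h) ≤ Φ z + N h := by
  set B : Set (Space d) := Ω ∩ (fun z => z + h) ⁻¹' Ω with hB
  have hBm : MeasurableSet B :=
    hΩ.measurableSet.inter ((measurable_add_const h) hΩ.measurableSet)
  have hBfin : volume B ≠ ⊤ := ((measure_mono inter_subset_left).trans_lt hΩ.measure_lt_top).ne
  have : IsFiniteMeasure ((volume : Measure (Space d)).restrict B) :=
    ⟨by simpa using hBfin.lt_top⟩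
  have i0 : Integrable Φ ((volume : Measure (Space d)).restrict B) :=
    Integrable.of_bound hΦ.aestronglyMeasurable C (Eventually.of_forall hΦC)
  have i1 : Integrable (fun z => Φ (z + h)) ((volume : Measure (Space d)).restrict B) :=
    Integrable.of_bound (hΦ.comp (measurable_add_const h)).aestronglyMeasurable C
      (Eventually.of_forall fun z => hΦC _)
  have key : (fun z => Φ (z + h)) ≤ᵐ[volume.restrict B] fun z => Φ z + N h := by
    -- It suffices to compare integrals over measurable `A ⊆ B`; there the supporting inequality is
    -- applied to the translated indicator of `A` minus the indicator itself.
    refine ae_le_of_forall_setIntegral_le i1 (i0.add (integrable_const _)) fun s hs _ => ?_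
    rw [Measure.restrict_restrict hs]
    set A := s ∩ B with hAdef
    have hA : MeasurableSet A := hs.inter hBm
    have hA₀ : A ⊆ Ω := fun z hz => hz.2.1
    have hA₁ : ∀ z ∈ A, z + h ∈ Ω := fun z hz => hz.2.2
    have hAfin : volume A ≠ ⊤ := ((measure_mono hA₀).trans_lt hΩ.measure_lt_top).ne
    set χ : Space d → ℝ := A.indicator (fun _ => (1 : ℝ)) with hχ
    have hχi : Integrable χ := (integrable_indicator_iff hA).2 (integrableOn_const hAfin)
    have k0 : Integrable fun z => Φ z * χ z :=
      hχi.bdd_mul hΦ.aestronglyMeasurable (Eventually.of_forall hΦC)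
    have k1 : Integrable fun z => Φ z * χ (z - h) :=
      (hχi.comp_sub_right h).bdd_mul hΦ.aestronglyMeasurable (Eventually.of_forall hΦC)
    have hle := hsupp (fun z => χ (z - h) - χ z) ((hχi.comp_sub_right h).sub hχi).integrableOn
    have hcost := ENNReal.toReal_le_of_le_ofReal
      (mul_nonneg (apply_nonneg N h) measureReal_nonneg)
      (minimalFlux_translation_le (N := N) (α := α) hΩ hΩc hA hA₀ hA₁)
    have hz0 : ∀ z, z ∉ Ω → Φ z * (χ (z - h) - χ z) = 0 := fun z hz => by
      have h1 : z ∉ A := fun hzA => hz (hA₀ hzA)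
      have h2 : z - h ∉ A := fun hzA => hz (by simpa using hA₁ _ hzA)
      simp [hχ, h1, h2]
    rw [setIntegral_eq_integral_of_forall_compl_eq_zero hz0] at hle
    simp only [mul_sub] at hle
    rw [integral_sub k1 k0] at hle
    have hind : ∀ g : Space d → ℝ, ∫ z, g z * χ z = ∫ z in A, g z := fun g => by
      rw [← integral_indicator hA]
      congr 1 with z
      by_cases hz : z ∈ A <;> simp [hχ, hz]
    have e1 : ∫ z, Φ z * χ (z - h) = ∫ z in A, Φ (z + h) := by
      rw [← hind, ← integral_sub_right_eq_self (fun z => Φ (z + h) * χ z) h]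
      simp
    have iA : IntegrableOn Φ A := IntegrableOn.mono_set i0 inter_subset_right
    rw [integral_add iA (integrableOn_const hAfin), setIntegral_const, smul_eq_mul, ← e1, ← hind]
    have := hle.trans hcost
    linarith
  filter_upwards [(ae_restrict_iff' hBm).1 key] with z hz h1 h2 using hz ⟨h1, h2⟩

/-- The exceptional null set depends on `h`. Fubini exchanges the quantifiers, and `h = w - z` turns
translates into pairs of points. Both orders are kept because later a point has to be good both as
`z` and as `w`. -/
theorem ae_ae_le_add_of_supporting (hΩ : IsCompact Ω) (hΩc : Convex ℝ Ω) {Φ : Space d → ℝ} {C : ℝ}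
    (hΦ : Measurable Φ) (hΦC : ∀ x, |Φ x| ≤ C)
    (hsupp : ∀ ρ : Space d → ℝ, IntegrableOn ρ Ω →
      ∫ x in Ω, Φ x * ρ x ≤ (minimalFlux N α Ω 0 ρ).toReal) :
    (∀ᵐ z, ∀ᵐ w, z ∈ Ω → w ∈ Ω → Φ w ≤ Φ z + N (w - z)) ∧
      ∀ᵐ w, ∀ᵐ z, z ∈ Ω → w ∈ Ω → Φ w ≤ Φ z + N (w - z) := by
  have hNm : Measurable N := (seminorm_continuous N).measurable
  have hΩm := hΩ.measurableSet
  have m1 : MeasurableSet {p : Space d × Space d |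
      p.2 ∈ Ω → p.2 + p.1 ∈ Ω → Φ (p.2 + p.1) ≤ Φ p.2 + N p.1} := by
    refine MeasurableSet.imp (measurable_snd hΩm) (MeasurableSet.imp
      ((measurable_snd.add measurable_fst) hΩm) (measurableSet_le ?_ ?_)) <;> fun_prop
  have m2 : MeasurableSet {p : Space d × Space d |
      p.1 ∈ Ω → p.2 ∈ Ω → Φ p.2 ≤ Φ p.1 + N (p.2 - p.1)} := by
    refine MeasurableSet.imp (measurable_fst hΩm) (MeasurableSet.imp
      (measurable_snd hΩm) (measurableSet_le ?_ ?_)) <;> fun_prop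
  have h1 := (Measure.ae_ae_comm (μ := (volume : Measure (Space d)))
    (ν := (volume : Measure (Space d)))
    (p := fun h z => z ∈ Ω → z + h ∈ Ω → Φ (z + h) ≤ Φ z + N h) m1).1
    (Eventually.of_forall fun h => ae_le_add_of_supporting hΩ hΩc hΦ hΦC hsupp h)
  have h2 : ∀ᵐ z, ∀ᵐ w, z ∈ Ω → w ∈ Ω → Φ w ≤ Φ z + N (w - z) := by
    filter_upwards [h1] with z hz
    filter_upwards [(measurePreserving_sub_right volume z).quasiMeasurePreserving.ae hz] with w hw
    simpa using hw
  exact ⟨h2, (Measure.ae_ae_comm (p := fun z w => z ∈ Ω → w ∈ Ω → Φ w ≤ Φ z + N (w - z)) m2).1 h2⟩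

end Transport

/-! ### A Lipschitz version of the potential -/

/-- McShane's extension with respect to a seminorm, truncated at the bounds of the function. -/
theorem exists_seminorm_lipschitz_extension (N : Seminorm ℝ (Space d)) {Z : Set (Space d)}
    (hZ : Z.Nonempty) {Φ : Space d → ℝ} {C : ℝ} (hC : ∀ x, |Φ x| ≤ C)
    (hΦ : ∀ z ∈ Z, ∀ w ∈ Z, Φ w ≤ Φ z + N (w - z)) :
    ∃ Ψ : Space d → ℝ, (∀ x y, Ψ x ≤ Ψ y + N (x - y)) ∧ (∀ x, |Ψ x| ≤ C) ∧ ∀ z ∈ Z, Ψ z = Φ z := by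
  have : Nonempty Z := hZ.to_subtype
  have hbdd : ∀ x, BddBelow (range fun z : Z => Φ z + N (x - z)) := fun x =>
    ⟨-C, by
      rintro _ ⟨z, rfl⟩
      have := (abs_le.1 (hC z)).1
      have := apply_nonneg N (x - z)
      simp only
      linarith⟩
  set Ψ : Space d → ℝ := fun x => ⨅ z : Z, (Φ z + N (x - z)) with hΨ
  have hL : ∀ x y, Ψ x ≤ Ψ y + N (x - y) := fun x y => by
    rw [← sub_le_iff_le_add]
    refine le_ciInf fun z => ?_
    have h1 : Ψ x ≤ Φ z + N (x - z) := ciInf_le (hbdd x) z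
    have h2 := map_add_le_add N (x - y) (y - z)
    rw [sub_add_sub_cancel] at h2
    linarith
  have hext : ∀ z ∈ Z, Ψ z = Φ z := fun z hz => by
    refine le_antisymm ?_ (le_ciInf fun w => hΦ w w.2 z hz)
    have h1 : Ψ z ≤ Φ z + N (z - z) := ciInf_le (hbdd z) ⟨z, hz⟩
    simpa using h1
  have hC0 : 0 ≤ C := (abs_nonneg _).trans (hC 0)
  refine ⟨fun x => max (-C) (min C (Ψ x)), fun x y => ?_, fun x => ?_, fun z hz => ?_⟩
  · have h1 := hL x y
    have h0 := apply_nonneg N (x - y)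
    simp only
    refine max_le ?_ ?_
    · linarith [le_max_left (-C) (min C (Ψ y))]
    · have h2 := le_max_right (-C) (min C (Ψ y))
      rcases le_total C (Ψ y) with h | h
      · rw [min_eq_left h] at h2 ⊢
        linarith [min_le_left C (Ψ x)]
      · rw [min_eq_right h] at h2 ⊢
        linarith [min_le_right C (Ψ x)]
  · exact abs_le.2 ⟨le_max_left _ _, max_le (by linarith) (min_le_left _ _)⟩
  · simp only [hext z hz, min_eq_right (abs_le.1 (hC z)).2, max_eq_right (abs_le.1 (hC z)).1]

/-- A function with the Lipschitz bound for almost every pair of points of `Ω` has a version that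
satisfies it everywhere. -/
theorem exists_lipschitz_version {N : Seminorm ℝ (Space d)} {Ω : Set (Space d)}
    (hΩc : Convex ℝ Ω) (hΩi : (interior Ω).Nonempty) {Φ : Space d → ℝ} {C : ℝ}
    (hC : ∀ x, |Φ x| ≤ C)
    (h₁ : ∀ᵐ z, ∀ᵐ w, z ∈ Ω → w ∈ Ω → Φ w ≤ Φ z + N (w - z))
    (h₂ : ∀ᵐ w, ∀ᵐ z, z ∈ Ω → w ∈ Ω → Φ w ≤ Φ z + N (w - z)) :
    ∃ Ψ : Space d → ℝ, (∀ x y, Ψ x ≤ Ψ y + N (x - y)) ∧ (∀ x, |Ψ x| ≤ C) ∧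
      Ψ =ᵐ[volume.restrict Ω] Φ := by
  set S : Set (Space d) := {z | (∀ᵐ w, z ∈ Ω → w ∈ Ω → Φ w ≤ Φ z + N (w - z)) ∧
    ∀ᵐ w, w ∈ Ω → z ∈ Ω → Φ z ≤ Φ w + N (z - w)} with hS
  have hSae : ∀ᵐ z, z ∈ S := by filter_upwards [h₁, h₂] with z a b using ⟨a, b⟩
  set Z : Set (Space d) := S ∩ interior Ω with hZ
  have hZne : Z.Nonempty := by
    obtain ⟨z, hz, hz'⟩ := (Measure.dense_of_ae hSae).inter_open_nonempty _ isOpen_interior hΩi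
    exact ⟨z, hz', hz⟩
  have hpair : ∀ z ∈ Z, ∀ w ∈ Z, Φ w ≤ Φ z + N (w - z) := by
    intro z hz w hw
    -- The bound holds only for almost every partner of `z` and of `w`, so it is applied through a
    -- common good point `u` near `z`; the detour costs at most `2 * N (u - z) < ε`.
    refine le_of_forall_pos_le_add fun ε hε => ?_
    have hopen : IsOpen (interior Ω ∩ {u | N (u - z) < ε / 2}) :=
      isOpen_interior.inter (isOpen_lt ((seminorm_continuous N).comp (continuous_sub_right z))
        continuous_const)
    obtain ⟨u, ⟨huΩ, hu⟩, hu1, hu2⟩ := (Measure.dense_of_ae (hz.1.1.and hw.1.2)).inter_open_nonempty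
      _ hopen ⟨z, hz.2, by simpa using half_pos hε⟩
    have a1 := hu1 (interior_subset hz.2) (interior_subset huΩ)
    have a2 := hu2 (interior_subset huΩ) (interior_subset hw.2)
    have a3 := map_add_le_add N (w - z) (z - u)
    rw [sub_add_sub_cancel, map_sub_rev N z u] at a3
    have a4 : N (u - z) < ε / 2 := hu
    linarith
  obtain ⟨Ψ, hΨL, hΨC, hΨ⟩ := exists_seminorm_lipschitz_extension N hZne hC hpair
  refine ⟨Ψ, hΨL, hΨC, ?_⟩
  -- The boundary of a convex set is a null set, so nothing is lost by working in the interior.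
  have hfr : ∀ᵐ x ∂(volume : Measure (Space d)), x ∉ frontier Ω :=
    measure_eq_zero_iff_ae_notMem.1 (hΩc.addHaar_frontier volume)
  rw [EventuallyEq, ae_restrict_iff'₀ (hΩc.nullMeasurableSet volume)]
  filter_upwards [hSae, hfr] with x hxS hxf hxΩ
  refine hΨ x ⟨hxS, ?_⟩
  by_contra hxi
  exact hxf ⟨subset_closure hxΩ, hxi⟩

/-- The dual problem of the minimal flux problem is solved by a Lipschitz function. -/
theorem exists_optimal_potential (N : Seminorm ℝ (Space d)) {α : ℝ} (hα : 0 < α)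
    {Ω : Set (Space d)} (hΩ : IsCompact Ω) (hΩc : Convex ℝ Ω) (hΩi : (interior Ω).Nonempty)
    {μ₀ μ₁ : Space d → ℝ} (h₀ : IntegrableOn μ₀ Ω) (h₁ : IntegrableOn μ₁ Ω) :
    ∃ Φ : Space d → ℝ, (∀ x y, Φ x ≤ Φ y + N (x - y)) ∧ (∀ x, |Φ x| ≤ 1 / α) ∧
      ∫ x in Ω, Φ x * (μ₁ x - μ₀ x) = (minimalFlux N α Ω μ₀ μ₁).toReal := by
  obtain ⟨Φ, hΦm, hΦC, hΦe, hΦs⟩ := exists_supporting_potential N hα hΩ h₀ h₁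
  obtain ⟨a, b⟩ := ae_ae_le_add_of_supporting hΩ hΩc hΦm hΦC hΦs
  obtain ⟨Ψ, hΨL, hΨC, hΨ⟩ := exists_lipschitz_version hΩc hΩi hΦC a b
  refine ⟨Ψ, hΨL, hΨC, ?_⟩
  rw [← hΦe]
  refine integral_congr_ae ?_
  filter_upwards [hΨ] with x hx
  rw [hx]

/-! ### Complementary slackness -/

theorem lipschitzWith_of_le_add_seminorm {N : Seminorm ℝ (Space d)} {Φ : Space d → ℝ}
    (hΦ : ∀ x y, Φ x ≤ Φ y + N (x - y)) : ∃ K : ℝ≥0, LipschitzWith K Φ := by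
  obtain ⟨C, hC0, hC⟩ := exists_seminorm_le N
  refine ⟨C.toNNReal, LipschitzWith.of_le_add_mul _ fun x y => ?_⟩
  rw [Real.coe_toNNReal C hC0.le, dist_eq_norm]
  linarith [hΦ x y, hC (x - y)]

/-- One-sided difference quotients in the direction `h` are at most `N h`. Where `Φ` is not
differentiable, `gradient` has the default value zero and the bound is trivial. -/
theorem inner_gradient_le_of_le_add_seminorm {N : Seminorm ℝ (Space d)} {Φ : Space d → ℝ}
    (hΦ : ∀ x y, Φ x ≤ Φ y + N (x - y)) (x h : Space d) : inner ℝ (gradient Φ x) h ≤ N h := by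
  by_cases hd : DifferentiableAt ℝ Φ x
  · rw [inner_gradient_left]
    have h1 : HasDerivAt (fun t : ℝ => x + t • h) h 0 := by
      simpa using ((hasDerivAt_id (0 : ℝ)).smul_const h).const_add x
    have h2 : HasDerivAt (fun t : ℝ => Φ (x + t • h)) (fderiv ℝ Φ x h) 0 :=
      HasFDerivAt.comp_hasDerivAt (f := fun t : ℝ => x + t • h) 0 (by simpa using hd.hasFDerivAt) h1
    refine le_of_tendsto h2.tendsto_slope_zero_right ?_
    filter_upwards [self_mem_nhdsWithin] with t ht
    have ht' : 0 < t := ht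
    have h3 := hΦ (x + t • h) x
    rw [add_sub_cancel_left, map_smul_eq_mul, Real.norm_of_nonneg ht'.le] at h3
    simp only [zero_add, zero_smul, add_zero, smul_eq_mul]
    rw [inv_mul_le_iff₀ ht']
    linarith
  · rw [gradient_eq_zero_of_not_differentiableAt hd, inner_zero_left]
    exact apply_nonneg N h

theorem IsMinimizer.staticCost_eq {N : Seminorm ℝ (Space d)} {α : ℝ} {Ω : Set (Space d)}
    {μ₀ μ₁ : Space d → ℝ} {m : Space d → Space d} {c : Space d → ℝ}
    (h : IsMinimizer N α Ω μ₀ μ₁ m c) : staticCost N α Ω m c = minimalFlux N α Ω μ₀ μ₁ :=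
  le_antisymm (le_iInf fun m' => le_iInf fun c' => le_iInf fun h' => h.2 m' c' h')
    h.1.minimalFlux_le

theorem toReal_staticCost {N : Seminorm ℝ (Space d)} {α : ℝ} (hα : 0 < α) {Ω : Set (Space d)}
    {m : Space d → Space d} {c : Space d → ℝ} (hm : IntegrableOn m Ω) (hc : IntegrableOn c Ω) :
    (staticCost N α Ω m c).toReal = (∫ x in Ω, N (m x)) + 1 / α * ∫ x in Ω, |c x| := by
  have hN := integrable_seminorm_comp N hm
  unfold staticCost
  rw [← ofReal_integral_eq_lintegral_ofReal hN (Eventually.of_forall fun _ => apply_nonneg N _),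
    ← ofReal_integral_eq_lintegral_ofReal hc.abs (Eventually.of_forall fun _ => abs_nonneg _),
    ← ENNReal.ofReal_mul (by positivity), ENNReal.toReal_add ENNReal.ofReal_ne_top
      ENNReal.ofReal_ne_top, ENNReal.toReal_ofReal (integral_nonneg fun _ => apply_nonneg N _),
    ENNReal.toReal_ofReal (mul_nonneg (by positivity) (integral_nonneg fun _ => abs_nonneg _))]

/-- Complementary slackness for the minimal flux problem. -/
theorem IsMinimizer.ae_slackness {N : Seminorm ℝ (Space d)} {α : ℝ} (hα : 0 < α)
    {Ω : Set (Space d)} (hΩ : IsCompact Ω) {μ₀ μ₁ : Space d → ℝ} (h₀ : IntegrableOn μ₀ Ω)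
    (h₁ : IntegrableOn μ₁ Ω) {m : Space d → Space d} {c : Space d → ℝ}
    (h : IsMinimizer N α Ω μ₀ μ₁ m c) {Φ : Space d → ℝ}
    (hΦ : ∀ x y, Φ x ≤ Φ y + N (x - y)) (hΦα : ∀ x, |Φ x| ≤ 1 / α)
    (hopt : ∫ x in Ω, Φ x * (μ₁ x - μ₀ x) = (minimalFlux N α Ω μ₀ μ₁).toReal) :
    ∀ᵐ x ∂(volume.restrict Ω), inner ℝ (gradient Φ x) (m x) = N (m x) ∧
      Φ x * c x = 1 / α * |c x| := by
  obtain ⟨K, hK⟩ := lipschitzWith_of_le_add_seminorm hΦ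
  have hm := h.1.integrable_flux
  have hc := h.1.integrable_source
  have hgi : IntegrableOn (fun x => inner ℝ (gradient Φ x) (m x)) Ω :=
    integrable_inner_of_bound (C := K) (measurable_gradient Φ).aestronglyMeasurable
      (Eventually.of_forall fun x => by
        rw [norm_gradient]
        exact norm_fderiv_le_of_lipschitz ℝ hK) hm
  have hci : IntegrableOn (fun x => Φ x * c x) Ω := hc.continuousOn_mul hK.continuous.continuousOn hΩ
  have hri : IntegrableOn (fun x => Φ x * (μ₁ x - μ₀ x)) Ω :=
    (h₁.sub h₀).continuousOn_mul hK.continuous.continuousOn hΩ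
  have hNi := integrable_seminorm_comp N hm
  have htest := h.1.integral_mul_eq_of_lipschitz hΩ h₀ h₁ hK
  simp only [mul_sub _ (μ₁ _ - μ₀ _)] at htest
  rw [integral_sub hri hci, hopt, ← h.staticCost_eq, toReal_staticCost hα hm hc,
    ← integral_const_mul] at htest
  have n1 : ∀ x, 0 ≤ N (m x) - inner ℝ (gradient Φ x) (m x) := fun x =>
    sub_nonneg.2 (inner_gradient_le_of_le_add_seminorm hΦ x (m x))
  have n2 : ∀ x, 0 ≤ 1 / α * |c x| - Φ x * c x := fun x => by
    refine sub_nonneg.2 ((le_abs_self _).trans ?_)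
    rw [abs_mul]
    exact mul_le_mul_of_nonneg_right (hΦα x) (abs_nonneg _)
  have i1 : IntegrableOn (fun x => N (m x) - inner ℝ (gradient Φ x) (m x)) Ω := hNi.sub hgi
  have i2 : IntegrableOn (fun x => 1 / α * |c x| - Φ x * c x) Ω := (hc.abs.const_mul _).sub hci
  have e1 := integral_sub hNi hgi
  have e2 := integral_sub (hc.abs.const_mul (1 / α)) hci
  have p1 := integral_nonneg (μ := volume.restrict Ω) (Pi.le_def.2 n1)
  have p2 := integral_nonneg (μ := volume.restrict Ω) (Pi.le_def.2 n2)
  -- By `htest` the integrals of the two nonnegative gaps add up to zero, so each gap vanishes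
  -- almost everywhere.
  have z1 := (integral_eq_zero_iff_of_nonneg n1 i1).1 (by linarith)
  have z2 := (integral_eq_zero_iff_of_nonneg n2 i2).1 (by linarith)
  filter_upwards [z1, z2] with x hx1 hx2
  simp only [Pi.zero_apply] at hx1 hx2
  exact ⟨by linarith, by linarith⟩

end UnnormalizedOT

end

/-! ### The main theorem -/

theorem mainTheorem3 {d : ℕ} (N : Seminorm ℝ (UnnormalizedOT.Space d))
    (hN : ∀ u, N u = 0 → u = 0) (α : ℝ) (hα : 0 < α)
    (Ω : Set (UnnormalizedOT.Space d)) (hΩ_compact : IsCompact Ω) (hΩ_convex : Convex ℝ Ω)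
    (hΩ_interior : (interior Ω).Nonempty)
    (μ₀ μ₁ : UnnormalizedOT.Space d → ℝ)
    (hμ₀ : UnnormalizedOT.IsDensity Ω μ₀) (hμ₁ : UnnormalizedOT.IsDensity Ω μ₁) :
    UnnormalizedOT.UW₁ N α Ω μ₀ μ₁ ≠ ⊤ ∧
    UnnormalizedOT.UW₁ N α Ω μ₀ μ₁ = UnnormalizedOT.minimalFlux N α Ω μ₀ μ₁ ∧
    (ContinuousOn μ₀ Ω → ContinuousOn μ₁ Ω →
      UnnormalizedOT.UW₁Continuous N α Ω μ₀ μ₁ = UnnormalizedOT.minimalFlux N α Ω μ₀ μ₁) ∧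
    ∃ Φ : UnnormalizedOT.Space d → ℝ, (∃ K, LipschitzOnWith K Φ Ω) ∧
      ∀ m c, UnnormalizedOT.IsMinimizer N α Ω μ₀ μ₁ m c →
        ∀ᵐ x ∂(volume.restrict Ω), DifferentiableAt ℝ Φ x ∧
          gradient Φ x ∈ UnnormalizedOT.subdifferential N (m x) ∧
          α * Φ x ∈ UnnormalizedOT.subdifferential (fun s : ℝ => |s|) (c x) := by
  have hfin := UnnormalizedOT.minimalFlux_ne_top (N := N) (α := α) hμ₀.1 hμ₁.1
  have heq : UnnormalizedOT.UW₁ N α Ω μ₀ μ₁ = UnnormalizedOT.minimalFlux N α Ω μ₀ μ₁ :=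
    le_antisymm (UnnormalizedOT.UW₁_le_minimalFlux hΩ_compact hμ₀ hμ₁)
      (UnnormalizedOT.minimalFlux_le_UW₁ hΩ_compact hμ₀ hμ₁)
  refine ⟨heq ▸ hfin, heq, fun hc₀ hc₁ => le_antisymm
    (UnnormalizedOT.UW₁Continuous_le_minimalFlux hΩ_compact hμ₀ hμ₁ hc₀ hc₁)
    (heq ▸ UnnormalizedOT.UW₁_le_UW₁Continuous N α Ω μ₀ μ₁), ?_⟩
  obtain ⟨Φ, hΦ, hΦα, hopt⟩ := UnnormalizedOT.exists_optimal_potential N hα hΩ_compact hΩ_convex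
    hΩ_interior hμ₀.1 hμ₁.1
  obtain ⟨K, hK⟩ := UnnormalizedOT.lipschitzWith_of_le_add_seminorm hΦ
  refine ⟨Φ, ⟨K, hK.lipschitzOnWith⟩, fun m c h => ?_⟩
  filter_upwards [h.ae_slackness hα hΩ_compact hμ₀.1 hμ₁.1 hΦ hΦα hopt,
    ae_restrict_of_ae (hK.ae_differentiableAt (μ := volume))] with x hx hd
  refine ⟨hd, fun y => ?_, fun y => ?_⟩
  -- The equality `∇Φ · m = N m` cancels the terms at `m x` and leaves `∇Φ · y ≤ N y`; the inclusion
  -- for `c` follows the same pattern.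
  · rw [inner_sub_right, hx.1]
    linarith [UnnormalizedOT.inner_gradient_le_of_le_add_seminorm hΦ x y]
  · have h1 : |α * Φ x| ≤ 1 := by
      rw [abs_mul, abs_of_pos hα]
      exact (mul_le_mul_of_nonneg_left (hΦα x) hα.le).trans_eq (mul_one_div_cancel hα.ne')
    have h2 : α * Φ x * y ≤ |y| := by
      refine (le_abs_self _).trans ?_
      rw [abs_mul]
      exact mul_le_of_le_one_left (abs_nonneg y) h1
    have h3 : α * Φ x * c x = |c x| := by
      rw [mul_assoc, hx.2, ← mul_assoc, mul_one_div_cancel hα.ne', one_mul]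
    have h4 : inner ℝ (α * Φ x) (y - c x) = α * Φ x * y - α * Φ x * c x := by
      simp only [RCLike.inner_apply, conj_trivial]
      ring
    simp only [h4, h3]
    linarith
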